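/- Let $n\ge 1$. A *body* in $\mathbb R^n$ is a bounded convex set $K\subset\mathbb R^n$ with $K=-K$ and non-empty interior. Its isotropic constant $L_K\ge 0$ is the number for which some invertible linear image $\tilde K$ of $K$ satisfies $\mathrm{Vol}(\tilde K)=1$ and $$\int_{\tilde K}\langle x,\theta\rangle^2\,dx=L_K^2\quad\text{for all }\theta\in S^{n-1};$$ such an image exists and $L_K$ does not depend on its choice. A function $f:\mathbb R^n\to[0,\infty)$ is *log-concave* if $\{f>0\}$ is convex and $\log f$ is concave on it. For an even log-concave $f$ with $0<\int_{\mathbb R^n}f<\infty$ let $M$ be its covariance matrix, $M_{i,j}=\frac{1}{\int f}\int_{\mathbb R^n} f(x)\,x_i x_j\,dx$, and put $$L_f=\left(\frac{f(0)}{\int_{\mathbb R^n} f}\right)^{1/n}\det(M)^{1/(2n)}.$$ Let $L_n=\sup_K L_K$, the supremum being over all bodies $K\subset\mathbb R^n$, and let $\tilde L_n=\sup_f L_f$, the supremum being over all even log-concave $f:\mathbb R^n\to[0,\infty)$ with $0<\int f<\infty$. **Corollary.** There is a constant $c>0$ such that for every integer $n\ge 1$, $$\tilde L_n< c\,L_n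 .$$ (The suprema are taken in $[0,\infty]$; in particular $\tilde L_n<\infty$.) -/

import Mathlib

open MeasureTheory
open scoped ENNReal

namespace Slicing

/-- The Euclidean space of dimension `n`. -/
abbrev E (n : ℕ) : Type := EuclideanSpace ℝ (Fin n)

/-- A body: a bounded, centrally symmetric convex set with non-empty interior. -/
structure IsBody {n : ℕ} (K : Set (E n)) : Prop where
  convex : Convex ℝ K
  symm : ∀ x ∈ K, -x ∈ K
  bounded : Bornology.IsBounded K
  interior_nonempty : (interior K).Nonempty

/-- `K` is in isotropic position with constant `L ≥ 0`: it has volume one, and the integral of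
`⟨x, θ⟩ ^ 2` over `K` equals `L ^ 2` for every unit vector `θ`. -/
structure IsIsotropicWith {n : ℕ} (K : Set (E n)) (L : ℝ) : Prop where
  volume_eq_one : volume K = 1
  nonneg : 0 ≤ L
  integral_eq : ∀ θ : E n, ‖θ‖ = 1 → ∫ x in K, (inner ℝ x θ) ^ 2 = L ^ 2

/-- The isotropic constant `L_K` of a body `K`: the number `L` such that some invertible linear
image of `K` is in isotropic position with constant `L`. For a body in dimension `n ≥ 1` there is
exactly one such `L`, so the supremum below is over a one-point set. -/
noncomputable def bodyConst {n : ℕ} (K : Set (E n)) : ℝ :=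
  sSup {L : ℝ | ∃ T : E n ≃ₗ[ℝ] E n, IsIsotropicWith (T '' K) L}

/-- `f ≥ 0` is log-concave: its support `{x | f x ≠ 0}` is convex, and `log f` is concave on it. -/
structure IsLogConcave {n : ℕ} (f : E n → ℝ) : Prop where
  nonneg : ∀ x, 0 ≤ f x
  concaveOn_log : ConcaveOn ℝ (Function.support f) (fun x => Real.log (f x))

/-- The functions for which the isotropic constant is considered: even, log-concave, and with
finite non-zero integral. -/
structure IsEvenLogConcaveDensity {n : ℕ} (f : E n → ℝ) : Prop where
  logConcave : IsLogConcave f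
  even : ∀ x, f (-x) = f x
  integrable : Integrable f
  integral_pos : 0 < ∫ x, f x

/-- The covariance matrix of the density `f`, in the standard orthonormal basis. -/
noncomputable def covMatrix {n : ℕ} (f : E n → ℝ) : Matrix (Fin n) (Fin n) ℝ :=
  Matrix.of fun i j => (1 / ∫ x, f x) * ∫ x, f x * x i * x j

/-- The isotropic constant `L_f = (f(0) / ∫ f) ^ (1 / n) * (det M) ^ (1 / (2n))`. -/
noncomputable def funConst {n : ℕ} (f : E n → ℝ) : ℝ :=
  (f 0 / ∫ x, f x) ^ (1 / (n : ℝ)) * (covMatrix f).det ^ (1 / (2 * (n : ℝ)))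

/-- `L_n`, the supremum of `L_K` over all bodies in dimension `n`, as an extended number. -/
noncomputable def supBody (n : ℕ) : ℝ≥0∞ :=
  ⨆ (K : Set (E n)) (_ : IsBody K), ENNReal.ofReal (bodyConst K)

/-- The supremum of `L_f` over all even log-concave functions in dimension `n`, as an extended
number. -/
noncomputable def supFun (n : ℕ) : ℝ≥0∞ :=
  ⨆ (f : E n → ℝ) (_ : IsEvenLogConcaveDensity f), ENNReal.ofReal (funConst f)

end Slicing

/-! The theorem compares `f` with Ball's body $K_f=\{x:(n+2)\int_0^\infty f(rx)r^{n+1}dr\ge f(0)\}$.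
The exponent $n+1=(n-1)+2$ is the polar Jacobian times a quadratic weight. Hence in polar
coordinates $K_f$ has exactly the second moments of $f/f(0)$ (`lintegral_inner_sq_ballBody`).

Convexity of $K_f$ (`convex_ballBody`) is Ball's inequality `ball_ineq`: transport one ray density
monotonically to the other, push along the harmonic mean $t=(a/r+b/s)^{-1}$, and bound the Jacobian
by the arithmetic-geometric mean inequality. Symmetry is clear, boundedness follows from exponential
decay of `f`, and continuity of `f` at the origin gives interior.

The volume needs only an upper bound, $f(0)\,\mathrm{Vol}(K_f)\le 2e^2\int f$
(`volume_ballBody_le`). On each ray, log-concavity makes `f` cross a suitable exponential with the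
same value at the origin only once, so a bound on the moment of order $n-1$ controls that of order
$n+1$ (`integral_ray_le`).

With $q=f(0)/\int f$ and $V=\mathrm{Vol}(K_f)$, determinants give $L_f^{2n}=(qV)^{n+2}L_{K_f}^{2n}$
(`funConst_pow`). Since $qV\le 2e^2$ and $n+2\le 4n$, it follows that $L_f\le(2e^2)^2L_{K_f}$.
Strictness comes from doubling the constant, which requires $0<L_n<\infty$; for finiteness, the
closure of an isotropic body contains a ball of radius $L_K$, while its volume is one
(`bodyConst_pow_le`). -/

namespace Slicing
open Set Filter Topology Matrix

variable {n : ℕ}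

/-! ### Monotone transport on the line. -/

/-- The distribution function of a positive continuous density on an open interval `U`. -/
theorem cdf_facts {U : Set ℝ} (hU : IsOpen U) (hUc : U.OrdConnected) {w : ℝ → ℝ}
    (hw : ContinuousOn w U) (hw0 : ∀ r ∈ U, 0 < w r) (hwi : IntegrableOn w U)
    (hw1 : ∫ r in U, w r = 1) :
    ∃ W : ℝ → ℝ, (∀ r ∈ U, HasDerivAt W (w r) r) ∧ StrictMonoOn W U ∧ W '' U = Ioo 0 1 := by
  have hi : Integrable (U.indicator w) := hwi.integrable_indicator hU.measurableSet
  have hnn : ∀ x, 0 ≤ U.indicator w x := indicator_nonneg fun x hx => (hw0 x hx).le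
  have htot : ∫ x, U.indicator w x = 1 := by rw [integral_indicator hU.measurableSet, hw1]
  set W : ℝ → ℝ := fun r => ∫ x in Iic r, U.indicator w x with hW
  have hsub : ∀ a r, W r = W a + ∫ x in a..r, U.indicator w x := by
    intro a r
    have := intervalIntegral.integral_Iic_sub_Iic (μ := volume) (f := U.indicator w) (a := a)
      (b := r) hi.integrableOn hi.integrableOn
    simp only [hW]; linarith
  have hder : ∀ r ∈ U, HasDerivAt W (w r) r := by
    intro r hr
    have h1 : HasDerivAt (fun u => ∫ x in r..u, U.indicator w x) (U.indicator w r) r := by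
      apply intervalIntegral.integral_hasDerivAt_right
      · simp
      · exact hi.aestronglyMeasurable.stronglyMeasurableAtFilter
      · refine (hw.continuousAt (hU.mem_nhds hr)).congr ?_
        filter_upwards [hU.mem_nhds hr] with x hx
        simp [hx]
    rw [indicator_of_mem hr] at h1
    exact (h1.const_add (W r)).congr_of_eventuallyEq (Eventually.of_forall fun u => hsub r u)
  have hmono : StrictMonoOn W U := by
    apply strictMonoOn_of_deriv_pos hUc.convex
    · exact fun r hr => (hder r hr).continuousAt.continuousWithinAt
    · intro r hr
      have hr := interior_subset hr
      rw [(hder r hr).deriv]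
      exact hw0 r hr
  have hcont : Continuous W := by
    have := intervalIntegral.continuous_primitive (μ := volume) (f := U.indicator w)
      (fun a b => hi.intervalIntegrable) 0
    refine ((continuous_const (y := W 0)).add this).congr fun r => (hsub 0 r).symm
  have hbot : Tendsto W atBot (𝓝 0) := by
    have h := intervalIntegral_tendsto_integral_Iic (μ := volume) (f := U.indicator w) 0
      hi.integrableOn (tendsto_id (α := ℝ) (x := atBot))
    have h2 := (tendsto_const_nhds (x := W 0)).sub h
    have : W 0 - ∫ x in Iic (0:ℝ), U.indicator w x = 0 := by simp [hW]
    rw [this] at h2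
    refine h2.congr fun r => ?_
    have := hsub r 0
    simp only [id]; linarith
  have htop : Tendsto W atTop (𝓝 1) := by
    have h := intervalIntegral_tendsto_integral_Ioi (μ := volume) (f := U.indicator w) 0
      hi.integrableOn (tendsto_id (α := ℝ) (x := atTop))
    have h2 := (tendsto_const_nhds (x := W 0)).add h
    have : W 0 + ∫ x in Ioi (0:ℝ), U.indicator w x = 1 := by
      rw [← htot, ← intervalIntegral.integral_Iic_add_Ioi (b := (0 : ℝ)) hi.integrableOn
        hi.integrableOn]
    rw [this] at h2
    exact h2.congr fun r => (hsub 0 r).symm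
  have hge : ∀ r, 0 ≤ W r := fun r => integral_nonneg hnn
  have hle : ∀ r, W r ≤ 1 := fun r => by
    rw [← htot]; exact setIntegral_le_integral hi (Eventually.of_forall hnn)
  refine ⟨W, hder, hmono, Subset.antisymm ?_ ?_⟩
  · rintro _ ⟨r, hr, rfl⟩
    -- Since `U` is open, `r` has neighbours in `U` on both sides; strict monotonicity keeps `W r`
    -- away from 0 and 1.
    obtain ⟨l, hl, hlU⟩ := mem_nhdsLT_iff_exists_Ico_subset.1
      (mem_nhdsWithin_of_mem_nhds (hU.mem_nhds hr) : U ∈ 𝓝[<] r)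
    obtain ⟨u, hu, huU⟩ := mem_nhdsGT_iff_exists_Ioc_subset.1
      (mem_nhdsWithin_of_mem_nhds (hU.mem_nhds hr) : U ∈ 𝓝[>] r)
    have hl : l < r := hl
    have hu : r < u := hu
    exact ⟨(hge l).trans_lt (hmono (hlU ⟨le_rfl, hl⟩) hr hl),
      (hmono hr (huU ⟨hu, le_rfl⟩) hu).trans_le (hle u)⟩
  · rintro τ ⟨h0, h1⟩
    obtain ⟨a, ha⟩ := (hbot.eventually (gt_mem_nhds h0)).exists
    obtain ⟨b, hb⟩ := (htop.eventually (lt_mem_nhds h1)).exists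
    obtain ⟨r, hr⟩ := mem_range_of_exists_le_of_exists_ge hcont ⟨a, ha.le⟩ ⟨b, hb.le⟩
    refine ⟨r, ?_, hr⟩
    by_contra hrU
    -- A point outside the interval `U` has all of `U` on one side, so `W` equals 1 or 0 there,
    -- contradicting `0 < τ < 1`.
    by_cases hA : ∃ u ∈ U, u < r
    · obtain ⟨u, hu, hur⟩ := hA
      have hall : ∀ x ∈ U, x ≤ r := by
        intro x hx
        by_contra! hxr
        exact hrU (hUc.out hu hx ⟨hur.le, hxr.le⟩)
      have : W r = 1 := by
        rw [← htot]
        exact setIntegral_eq_integral_of_forall_compl_eq_zero fun x hx =>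
          indicator_of_notMem (fun hxU => hx (hall x hxU)) _
      linarith
    · push Not at hA
      have : W r = 0 := by
        refine setIntegral_eq_zero_of_forall_eq_zero fun x hx => ?_
        refine indicator_of_notMem (fun hxU => hrU ?_) _
        rwa [← le_antisymm hx (hA x hxU)]
      linarith

/-- Monotone transport between two positive continuous densities on open intervals. -/
theorem exists_transport {U V : Set ℝ} (hU : IsOpen U) (hUc : U.OrdConnected)
    (hV : IsOpen V) (hVc : V.OrdConnected) {w v : ℝ → ℝ}
    (hw : ContinuousOn w U) (hw0 : ∀ r ∈ U, 0 < w r) (hwi : IntegrableOn w U)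
    (hw1 : ∫ r in U, w r = 1)
    (hv : ContinuousOn v V) (hv0 : ∀ r ∈ V, 0 < v r) (hvi : IntegrableOn v V)
    (hv1 : ∫ r in V, v r = 1) :
    ∃ S : ℝ → ℝ, ∀ r ∈ U, S r ∈ V ∧ HasDerivAt S (w r / v (S r)) r := by
  obtain ⟨W, hWd, hWm, hWi⟩ := cdf_facts hU hUc hw hw0 hwi hw1
  obtain ⟨X, hXd, hXm, hXi⟩ := cdf_facts hV hVc hv hv0 hvi hv1
  have hinv : ∀ τ ∈ Ioo (0:ℝ) 1, ∃ s ∈ V, X s = τ := fun τ hτ => by rwa [← hXi] at hτ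
  choose! N hNV hNX using hinv
  have hNmono : StrictMonoOn N (Ioo 0 1) := by
    intro a ha b hb hab
    rw [← hXm.lt_iff_lt (hNV a ha) (hNV b hb), hNX a ha, hNX b hb]
    exact hab
  have hNimg : N '' Ioo 0 1 = V := by
    refine Subset.antisymm (image_subset_iff.2 hNV) fun s hs => ?_
    have hXs : X s ∈ Ioo (0:ℝ) 1 := hXi ▸ mem_image_of_mem X hs
    exact ⟨X s, hXs, hXm.injOn (hNV _ hXs) hs (hNX _ hXs)⟩
  refine ⟨fun r => N (W r), fun r hr => ?_⟩
  have hWr : W r ∈ Ioo (0:ℝ) 1 := hWi ▸ mem_image_of_mem W hr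
  have hnb : Ioo (0:ℝ) 1 ∈ 𝓝 (W r) := isOpen_Ioo.mem_nhds hWr
  have hs := hNV _ hWr
  have hNc : ContinuousAt N (W r) := by
    apply hNmono.continuousAt_of_image_mem_nhds hnb
    rw [hNimg]
    exact hV.mem_nhds hs
  have hNd : HasDerivAt N (v (N (W r)))⁻¹ (W r) :=
    HasDerivAt.of_local_left_inverse hNc (hXd _ hs) (hv0 _ hs).ne'
      (by filter_upwards [hnb] with τ hτ using hNX τ hτ)
  refine ⟨hs, ?_⟩
  have := hNd.comp r (hWd r hr)
  rwa [inv_mul_eq_div] at this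

/-! ### Ball's inequality for two densities on half-lines. -/

/-- Two applications of the weighted arithmetic-geometric mean inequality. -/
theorem ball_pointwise {q : ℕ} {a b r s t g h m G H c : ℝ} (ha : 0 < a) (hb : 0 < b)
    (hab : a + b = 1) (hr : 0 < r) (hs : 0 < s) (ht : t = (a / r + b / s)⁻¹)
    (hg : 0 < g) (hh : 0 < h) (hc : 0 < c) (hG : c ≤ G) (hH : c ≤ H)
    (hm : g ^ (a * t / r) * h ^ (b * t / s) ≤ m) :
    g * r ^ q / G * c ≤
      t ^ 2 * (a / r ^ 2 + b * ((g * r ^ q / G) / (h * s ^ q / H)) / s ^ 2) * (m * t ^ q) := by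
  have hGp := hc.trans_le hG
  have hHp := hc.trans_le hH
  have htp : 0 < t := by rw [ht]; positivity
  set θ := a * t / r with hθ
  set η := b * t / s with hη
  have hθp : 0 < θ := by positivity
  have hηp : 0 < η := by positivity
  have hθη : θ + η = 1 := by
    have : (a / r + b / s) * t = 1 := by
      rw [ht]; exact mul_inv_cancel₀ (by positivity)
    rw [← this, hθ, hη]; ring
  -- The arithmetic mean here is `θ * r / t + η * s / t = a + b = 1`.
  have hone : (r / t) ^ θ * (s / t) ^ η ≤ 1 := by
    have := Real.geom_mean_le_arith_mean2_weighted hθp.le hηp.le (p₁ := r / t) (p₂ := s / t)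
      (by positivity) (by positivity) hθη
    refine this.trans_eq ?_
    rw [hθ, hη, ← hab]; field_simp
  have hone' : 1 ≤ ((t / r) ^ (q + 1)) ^ θ * ((t / s) ^ (q + 1)) ^ η := by
    have h1 : ((t / r) ^ (q + 1)) ^ θ * ((t / s) ^ (q + 1)) ^ η
        = (((r / t) ^ θ * (s / t) ^ η)⁻¹) ^ (q + 1) := by
      rw [← Real.rpow_natCast, ← Real.rpow_natCast (t / s), ← Real.rpow_mul (by positivity),
        ← Real.rpow_mul (by positivity), mul_inv, mul_pow, ← Real.inv_rpow (by positivity),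
        ← Real.inv_rpow (by positivity), inv_div, inv_div, ← Real.rpow_mul_natCast (by positivity),
        ← Real.rpow_mul_natCast (by positivity)]
      push_cast
      rw [mul_comm θ, mul_comm η]
    rw [h1]
    exact one_le_pow₀ ((one_le_inv₀ (by positivity)).2 hone)
  -- This arithmetic mean is the derivative of the harmonic-mean map times `t ^ q`, divided by the
  -- first density `g r * r ^ q / G`.
  have hAG := Real.geom_mean_le_arith_mean2_weighted hθp.le hηp.le
    (p₁ := (t / r) ^ (q + 1) * G / g) (p₂ := (t / s) ^ (q + 1) * H / h)
    (by positivity) (by positivity) hθη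
  have hlow : c ≤ (θ * ((t / r) ^ (q + 1) * G / g) + η * ((t / s) ^ (q + 1) * H / h)) * m := by
    calc c = c ^ θ * c ^ η * 1 := by rw [← Real.rpow_add hc, hθη, Real.rpow_one, mul_one]
      _ ≤ G ^ θ * H ^ η * (((t / r) ^ (q + 1)) ^ θ * ((t / s) ^ (q + 1)) ^ η) := by gcongr
      _ = ((t / r) ^ (q + 1) * G / g) ^ θ * ((t / s) ^ (q + 1) * H / h) ^ η
            * (g ^ θ * h ^ η) := by
          rw [Real.div_rpow (by positivity) hg.le, Real.div_rpow (by positivity) hh.le,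
            Real.mul_rpow (by positivity) (by positivity),
            Real.mul_rpow (by positivity) (by positivity)]
          field_simp
      _ ≤ _ := by gcongr
  calc g * r ^ q / G * c ≤ g * r ^ q / G *
        ((θ * ((t / r) ^ (q + 1) * G / g) + η * ((t / s) ^ (q + 1) * H / h)) * m) := by gcongr
    _ = _ := by
      rw [hθ, hη, div_pow, div_pow]
      field_simp
      ring

/-- Ball's inequality along the segment between two rays. -/
theorem ball_ineq {U V : Set ℝ} (hU : IsOpen U) (hUc : U.OrdConnected)
    (hV : IsOpen V) (hVc : V.OrdConnected) (hUp : ∀ r ∈ U, 0 < r) (hVp : ∀ r ∈ V, 0 < r)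
    {g h m : ℝ → ℝ} {q : ℕ} {a b c : ℝ} (ha : 0 < a) (hb : 0 < b) (hab : a + b = 1)
    (hg : ContinuousOn g U) (hg0 : ∀ r ∈ U, 0 < g r) (hgi : IntegrableOn (fun r => g r * r ^ q) U)
    (hh : ContinuousOn h V) (hh0 : ∀ r ∈ V, 0 < h r) (hhi : IntegrableOn (fun r => h r * r ^ q) V)
    (hc : 0 < c) (hG : c ≤ ∫ r in U, g r * r ^ q) (hH : c ≤ ∫ r in V, h r * r ^ q)
    (hm : ∀ r ∈ U, ∀ s ∈ V, g r ^ (a * (a / r + b / s)⁻¹ / r) * h s ^ (b * (a / r + b / s)⁻¹ / s)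
      ≤ m (a / r + b / s)⁻¹) :
    ENNReal.ofReal c ≤ ∫⁻ t in Ioi (0:ℝ), ENNReal.ofReal (m t * t ^ q) := by
  set G := ∫ r in U, g r * r ^ q with hGdef
  set H := ∫ r in V, h r * r ^ q with hHdef
  have hGp := hc.trans_le hG
  have hHp := hc.trans_le hH
  obtain ⟨S, hS⟩ := exists_transport hU hUc hV hVc (w := fun r => g r * r ^ q / G)
    (v := fun r => h r * r ^ q / H)
    ((hg.mul (by fun_prop)).div_const _)
    (fun r hr => by have := hg0 r hr; have := hUp r hr; positivity)
    (hgi.div_const _) (by rw [integral_div, ← hGdef, div_self hGp.ne'])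
    ((hh.mul (by fun_prop)).div_const _)
    (fun r hr => by have := hh0 r hr; have := hVp r hr; positivity)
    (hhi.div_const _) (by rw [integral_div, ← hHdef, div_self hHp.ne'])
  -- With `s = S r` and `t = T r`, the point `t • (a • x + b • y)` is the convex combination of `r •
  -- x` and `s • y` with weights `a * t / r` and `b * t / s`.
  set T : ℝ → ℝ := fun r => (a / r + b / S r)⁻¹ with hT
  set T' : ℝ → ℝ := fun r => T r ^ 2 * (a / r ^ 2 +
    b * ((g r * r ^ q / G) / (h (S r) * S r ^ q / H)) / S r ^ 2) with hT'
  have hTd : ∀ r ∈ U, HasDerivAt T (T' r) r := by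
    intro r hr
    obtain ⟨hSV, hSd⟩ := hS r hr
    have hr0 := hUp r hr
    have hs0 := hVp _ hSV
    have h1 := (((hasDerivAt_id r).inv hr0.ne').const_mul a).add
      ((hSd.inv hs0.ne').const_mul b)
    have h2 := h1.inv (by simp only [Pi.add_apply, id, Pi.inv_apply]; positivity)
    refine (h2.congr_of_eventuallyEq (Eventually.of_forall fun u => ?_)).congr_deriv ?_
    · simp [hT, div_eq_mul_inv]
    · simp only [hT', hT, Pi.add_apply, Pi.inv_apply, id, div_eq_mul_inv, inv_pow]
      ring
  have hT'p : ∀ r ∈ U, 0 < T' r := by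
    intro r hr
    have hr0 := hUp r hr
    have hs0 := hVp _ (hS r hr).1
    have := hg0 r hr
    have := hh0 _ (hS r hr).1
    have : 0 < T r := by simp only [hT]; positivity
    simp only [hT']; positivity
  have hTm : StrictMonoOn T U := by
    apply strictMonoOn_of_deriv_pos hUc.convex
    · exact fun r hr => (hTd r hr).continuousAt.continuousWithinAt
    · intro r hr
      have hr := interior_subset hr
      rw [(hTd r hr).deriv]
      exact hT'p r hr
  have hsub : T '' U ⊆ Ioi 0 := by
    rintro _ ⟨r, hr, rfl⟩
    have hr0 := hUp r hr
    have hs0 := hVp _ (hS r hr).1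
    simp only [hT, mem_Ioi]; positivity
  calc ENNReal.ofReal c = ENNReal.ofReal (∫ r in U, g r * r ^ q / G * c) := by
        rw [integral_mul_const, integral_div, ← hGdef, div_self hGp.ne', one_mul]
    _ = ∫⁻ r in U, ENNReal.ofReal (g r * r ^ q / G * c) := by
        rw [ofReal_integral_eq_lintegral_ofReal ((hgi.div_const _).mul_const _)]
        filter_upwards [ae_restrict_mem hU.measurableSet] with r hr
        have := hg0 r hr; have := hUp r hr
        simp only [Pi.zero_apply]; positivity
    _ ≤ ∫⁻ r in U, ENNReal.ofReal |T' r| * ENNReal.ofReal (m (T r) * T r ^ q) := by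
        refine setLIntegral_mono' hU.measurableSet fun r hr => ?_
        rw [← ENNReal.ofReal_mul (abs_nonneg _), abs_of_pos (hT'p r hr)]
        apply ENNReal.ofReal_le_ofReal
        obtain ⟨hSV, -⟩ := hS r hr
        exact ball_pointwise ha hb hab (hUp r hr) (hVp _ hSV) rfl (hg0 r hr) (hh0 _ hSV) hc hG hH
          (hm r hr _ hSV)
    _ = ∫⁻ t in T '' U, ENNReal.ofReal (m t * t ^ q) :=
        (lintegral_image_eq_lintegral_abs_deriv_mul hU.measurableSet
          (fun r hr => (hTd r hr).hasDerivWithinAt) hTm.injOn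
          (fun t => ENNReal.ofReal (m t * t ^ q))).symm
    _ ≤ _ := lintegral_mono_set hsub

/-! ### Symmetric convex sets of finite volume. -/

/-- A small vector `w` is the midpoint of `z + w` and `-(z - w)`, for `z` interior to `K`. -/
theorem exists_ball_subset_of_symm {K : Set (E n)} (hc : Convex ℝ K) (hs : ∀ x ∈ K, -x ∈ K)
    (hi : (interior K).Nonempty) : ∃ ε > 0, Metric.ball 0 ε ⊆ K := by
  obtain ⟨z, hz⟩ := hi
  obtain ⟨ε, hε, hb⟩ := Metric.isOpen_iff.1 isOpen_interior z hz
  refine ⟨ε, hε, fun w hw => ?_⟩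
  have hw : ‖w‖ < ε := by simpa using hw
  have h1 : z + w ∈ K := interior_subset (hb (by simpa [dist_eq_norm] using hw))
  have h2 : w - z ∈ K := by
    have : z - w ∈ K := interior_subset (hb (by simpa [dist_eq_norm] using hw))
    simpa using hs _ this
  have := hc h1 h2 (a := 1 / 2) (b := 1 / 2) (by norm_num) (by norm_num) (by norm_num)
  convert this using 1
  module

/-- A symmetric convex set with non-empty interior and finite volume is bounded. -/
theorem isBounded_of_volume_ne_top {K : Set (E n)} (hc : Convex ℝ K) (hs : ∀ x ∈ K, -x ∈ K)
    (hi : (interior K).Nonempty) (hv : volume K ≠ ∞) : Bornology.IsBounded K := by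
  obtain ⟨ε, hε, hb⟩ := exists_ball_subset_of_symm hc hs hi
  have hpos : volume (Metric.ball (0 : E n) (ε / 2)) ≠ 0 :=
    (Metric.measure_ball_pos volume _ (by positivity)).ne'
  obtain ⟨N, hN⟩ := ENNReal.exists_nat_mul_gt hpos hv
  rw [isBounded_iff_forall_norm_le]
  -- A longer `x` would leave room for `N` disjoint balls of radius `ε / 2` centred on the first
  -- half of the segment from 0 to `x`, exceeding the volume of `K`.
  refine ⟨2 * ε * (N + 1), fun x hx => ?_⟩
  by_contra! hlt
  have hxp : 0 < ‖x‖ := lt_of_le_of_lt (by positivity) hlt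
  have hsub : ∀ k ∈ Finset.range N, Metric.ball ((k * ε / ‖x‖) • x) (ε / 2) ⊆ K := by
    intro k hk w hw
    have hkN : (k : ℝ) ≤ N := by exact_mod_cast (Finset.mem_range.1 hk).le
    set t := k * ε / ‖x‖ with ht
    have ht0 : 0 ≤ t := by positivity
    have ht1 : t ≤ 1 / 2 := by
      rw [ht, div_le_iff₀ hxp]
      nlinarith
    have hw : ‖w - t • x‖ < ε / 2 := by simpa [dist_eq_norm] using hw
    -- Since `t ≤ 1 / 2`, the dilation at most doubles a vector shorter than `ε / 2`.
    have h2 : (1 - t)⁻¹ • (w - t • x) ∈ K := by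
      apply hb
      rw [mem_ball_zero_iff, norm_smul, Real.norm_of_nonneg (inv_nonneg.2 (by linarith)),
        inv_mul_lt_iff₀ (by linarith)]
      nlinarith
    have := hc hx h2 (a := t) (b := 1 - t) ht0 (by linarith) (by ring)
    rwa [smul_smul, mul_inv_cancel₀ (by linarith : (1 - t) ≠ 0), one_smul, add_sub_cancel] at this
  have hdisj : (Finset.range N : Set ℕ).PairwiseDisjoint
      (fun k : ℕ => Metric.ball ((k * ε / ‖x‖) • x) (ε / 2)) := by
    intro k _ l _ hkl
    apply Metric.ball_disjoint_ball
    rw [dist_eq_norm, ← sub_smul, norm_smul, ← sub_div, norm_div, norm_norm,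
      div_mul_cancel₀ _ hxp.ne', ← sub_mul, norm_mul, Real.norm_of_nonneg hε.le]
    have : (1 : ℝ) ≤ ‖(k : ℝ) - l‖ := by
      rw [Real.norm_eq_abs]
      have h : (1 : ℤ) ≤ |(k : ℤ) - l| := Int.one_le_abs (by omega)
      exact_mod_cast h
    nlinarith
  have hm := measure_biUnion_finset (μ := volume) hdisj fun k _ => measurableSet_ball
  have hle : volume (⋃ k ∈ Finset.range N, Metric.ball (((k : ℝ) * ε / ‖x‖) • x) (ε / 2))
      ≤ volume K := measure_mono (iUnion₂_subset hsub)
  rw [hm] at hle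
  simp only [Measure.addHaar_ball_center, Finset.sum_const, Finset.card_range, nsmul_eq_mul] at hle
  exact absurd hN (not_lt.2 hle)

/-! ### Even log-concave functions: maximum at the origin, continuity, decay. -/

namespace IsLogConcave

variable {f : E n → ℝ}

theorem rpow_mul_rpow_le (hf : IsLogConcave f) {x y : E n} (hx : x ∈ Function.support f)
    (hy : y ∈ Function.support f) {a b : ℝ} (ha : 0 ≤ a) (hb : 0 ≤ b) (hab : a + b = 1) :
    f x ^ a * f y ^ b ≤ f (a • x + b • y) := by
  have hp : ∀ z ∈ Function.support f, 0 < f z := fun z hz => (hf.nonneg z).lt_of_ne' hz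
  have hz := hf.concaveOn_log.1 hx hy ha hb hab
  have := hf.concaveOn_log.2 hx hy ha hb hab
  rw [Real.rpow_def_of_pos (hp x hx), Real.rpow_def_of_pos (hp y hy), ← Real.exp_add]
  refine (Real.le_log_iff_exp_le (hp _ hz)).1 ?_
  simpa [mul_comm] using this

theorem convex_superlevel (hf : IsLogConcave f) {c : ℝ} (hc : 0 < c) :
    Convex ℝ {x | c ≤ f x} := by
  intro x hx y hy a b ha hb hab
  have hx' : c ≤ f x := hx
  have hy' : c ≤ f y := hy
  calc c = c ^ a * c ^ b := by rw [← Real.rpow_add hc, hab, Real.rpow_one]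
    _ ≤ f x ^ a * f y ^ b := by
        have := hf.nonneg x
        gcongr
    _ ≤ _ := hf.rpow_mul_rpow_le (hc.trans_le hx').ne' (hc.trans_le hy').ne' ha hb hab

end IsLogConcave

namespace IsEvenLogConcaveDensity

variable {f : E n → ℝ}

theorem le_zero (hf : IsEvenLogConcaveDensity f) (x : E n) : f x ≤ f 0 := by
  by_cases hx : f x = 0
  · rw [hx]; exact hf.logConcave.nonneg 0
  have hpos : 0 < f x := (hf.logConcave.nonneg x).lt_of_ne' hx
  have := hf.logConcave.convex_superlevel hpos (x := x) (y := -x) (le_refl (f x)) (hf.even x).ge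
    (a := 1 / 2) (b := 1 / 2) (by norm_num) (by norm_num) (by norm_num)
  simpa using this

theorem zero_pos (hf : IsEvenLogConcaveDensity f) : 0 < f 0 := by
  by_contra! h
  have : f = 0 := funext fun x => le_antisymm ((hf.le_zero x).trans h) (hf.logConcave.nonneg x)
  have h2 := hf.integral_pos
  simp [this] at h2

theorem symm_support (hf : IsEvenLogConcaveDensity f) :
    ∀ x ∈ Function.support f, -x ∈ Function.support f := fun x hx => by
  rw [Function.mem_support, hf.even]; exact hx

/-- A convex set with empty interior lies in its own frontier, which is null; the integral of `f`
would then vanish. -/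
theorem interior_support_nonempty (hf : IsEvenLogConcaveDensity f) :
    (interior (Function.support f)).Nonempty := by
  by_contra h
  rw [not_nonempty_iff_eq_empty] at h
  have h0 : volume (Function.support f) = 0 := by
    refine measure_mono_null ?_ (hf.logConcave.concaveOn_log.1.addHaar_frontier volume)
    rw [frontier, h, sdiff_empty]
    exact subset_closure
  have : f =ᵐ[volume] 0 := by
    rw [EventuallyEq, ae_iff]; exact h0
  have h2 := hf.integral_pos
  rw [integral_congr_ae this] at h2
  simp at h2

theorem exists_ball_subset_support (hf : IsEvenLogConcaveDensity f) :
    ∃ ε > 0, Metric.ball 0 ε ⊆ Function.support f :=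
  exists_ball_subset_of_symm hf.logConcave.concaveOn_log.1 hf.symm_support
    hf.interior_support_nonempty

theorem zero_mem_interior_support (hf : IsEvenLogConcaveDensity f) :
    0 ∈ interior (Function.support f) := by
  obtain ⟨ε, hε, h⟩ := hf.exists_ball_subset_support
  exact interior_maximal h Metric.isOpen_ball (Metric.mem_ball_self hε)

theorem continuousOn_interior_support (hf : IsEvenLogConcaveDensity f) :
    ContinuousOn f (interior (Function.support f)) := by
  have h := hf.logConcave.concaveOn_log.subset interior_subset
    hf.logConcave.concaveOn_log.1.interior
  have hc := Real.continuous_exp.comp_continuousOn (h.continuousOn isOpen_interior)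
  refine hc.congr fun x hx => ?_
  exact (Real.exp_log ((hf.logConcave.nonneg x).lt_of_ne' (interior_subset hx))).symm

theorem eventually_lt (hf : IsEvenLogConcaveDensity f) {c : ℝ} (hc : c < f 0) :
    ∀ᶠ x in 𝓝 (0 : E n), c < f x :=
  (hf.continuousOn_interior_support.continuousAt
    (isOpen_interior.mem_nhds hf.zero_mem_interior_support)).eventually (lt_mem_nhds hc)

/-- Exponential decay. -/
theorem exists_decay (hf : IsEvenLogConcaveDensity f) :
    ∃ R > 0, ∀ x, f x ≤ f 0 * Real.exp 1 * Real.exp (-(‖x‖ / R)) := by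
  have h0 := hf.zero_pos
  have he : 1 < Real.exp 1 := by simp
  -- Beyond the bounded level set `{c ≤ f}`, `log f` has dropped by more than 1 over a length `R`;
  -- concavity makes the decrease at least linear. The extra factor `exp 1` in the bound covers `‖x‖
  -- < R`.
  set c := f 0 / Real.exp 1 with hc
  have hcp : 0 < c := by positivity
  have hc0 : c < f 0 := div_lt_self h0 he
  have hb : Bornology.IsBounded {x | c ≤ f x} := by
    apply isBounded_of_volume_ne_top (hf.logConcave.convex_superlevel hcp)
    · intro x hx
      have : c ≤ f x := hx
      simpa [hf.even] using this
    · refine ⟨0, mem_interior_iff_mem_nhds.2 ?_⟩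
      filter_upwards [hf.eventually_lt hc0] with x hx using hx.le
    · have := hf.integrable.measure_norm_ge_lt_top hcp
      refine ((measure_mono fun x hx => ?_).trans_lt this).ne
      have : c ≤ f x := hx
      exact this.trans (le_abs_self _)
  obtain ⟨R, hR, hRb⟩ := hb.exists_pos_norm_lt
  refine ⟨R, hR, fun x => ?_⟩
  rcases lt_or_ge ‖x‖ R with hx | hx
  · refine (hf.le_zero x).trans ?_
    rw [mul_assoc, ← Real.exp_add]
    refine le_mul_of_one_le_right h0.le (Real.one_le_exp ?_)
    have := (div_lt_one hR).2 hx
    linarith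
  by_cases hfx : f x = 0
  · rw [hfx]; positivity
  have hfp : 0 < f x := (hf.logConcave.nonneg x).lt_of_ne' hfx
  have hxp : 0 < ‖x‖ := hR.trans_le hx
  set t := R / ‖x‖ with ht
  have htp : 0 < t := by positivity
  have ht1 : t ≤ 1 := (div_le_one hxp).2 hx
  have h1 := hf.logConcave.rpow_mul_rpow_le (x := x) (y := 0) hfx h0.ne' htp.le
    (sub_nonneg.2 ht1) (by ring)
  have h2 : f (t • x + (1 - t) • 0) < c := by
    by_contra! hge
    have := hRb _ hge
    rw [smul_zero, add_zero, norm_smul, Real.norm_of_nonneg htp.le, ht,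
      div_mul_cancel₀ _ hxp.ne'] at this
    exact lt_irrefl _ this
  have h3 := Real.log_lt_log (by positivity) (h1.trans_lt h2)
  rw [Real.log_mul (by positivity) (by positivity), Real.log_rpow hfp, Real.log_rpow h0, hc,
    Real.log_div h0.ne' (by positivity), Real.log_exp] at h3
  have h4 : t * (Real.log (f x) - Real.log (f 0)) < -1 := by linarith
  have h5 : Real.log (f x) - Real.log (f 0) < -(‖x‖ / R) := by
    have : Real.log (f x) - Real.log (f 0) < -1 / t := by rw [lt_div_iff₀ htp]; linarith
    rwa [ht, neg_div, one_div_div] at this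
  have h6 : f x ≤ f 0 * Real.exp (-(‖x‖ / R)) := by
    rw [← Real.exp_log hfp, ← Real.exp_log h0, ← Real.exp_add]
    exact Real.exp_le_exp.2 (by linarith)
  refine h6.trans ?_
  gcongr
  exact le_mul_of_one_le_right h0.le he.le

/-- Restricting to the interior of the support does not change anything essential. -/
theorem exists_open_support (hf : IsEvenLogConcaveDensity f) :
    ∃ g : E n → ℝ, IsEvenLogConcaveDensity g ∧ IsOpen (Function.support g) ∧
      funConst g = funConst f := by
  set Ω := interior (Function.support f) with hΩ
  have hsupp : Function.support (Ω.indicator f) = Ω := by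
    rw [support_indicator, inter_eq_left]; exact interior_subset
  -- Only the frontier of the convex support is discarded, a null set that does not contain the
  -- origin.
  have hae : Ω.indicator f =ᵐ[volume] f := by
    have h0 := hf.logConcave.concaveOn_log.1.addHaar_frontier volume
    filter_upwards [measure_eq_zero_iff_ae_notMem.1 h0] with x hx
    by_cases hxΩ : x ∈ Ω
    · simp [hxΩ]
    · rw [indicator_of_notMem hxΩ]
      by_contra hne
      exact hx ⟨subset_closure (Ne.symm hne), hxΩ⟩
  have hint := integral_congr_ae hae
  have hneg : ∀ x ∈ Ω, -x ∈ Ω := by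
    intro x hx
    rw [hΩ, mem_interior_iff_mem_nhds] at hx ⊢
    have : Tendsto (fun y : E n => -y) (𝓝 (-x)) (𝓝 x) := by
      simpa using (continuous_neg.tendsto (-x) : Tendsto (fun y : E n => -y) _ _)
    filter_upwards [this hx] with y hy
    simpa using hf.symm_support _ hy
  refine ⟨Ω.indicator f, ⟨⟨fun x => indicator_nonneg (fun y _ => hf.logConcave.nonneg y) x, ?_⟩,
    fun x => ?_, hf.integrable.congr hae.symm, ?_⟩, ?_, ?_⟩
  · rw [hsupp]
    refine (hf.logConcave.concaveOn_log.subset interior_subset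
      hf.logConcave.concaveOn_log.1.interior).congr fun x hx => ?_
    rw [indicator_of_mem hx]
  · by_cases hx : x ∈ Ω
    · rw [indicator_of_mem hx, indicator_of_mem (hneg x hx), hf.even]
    · rw [indicator_of_notMem hx, indicator_of_notMem fun h => hx (by simpa using hneg _ h)]
  · rw [hint]; exact hf.integral_pos
  · rw [hsupp]; exact isOpen_interior
  · have h0 : Ω.indicator f 0 = f 0 := indicator_of_mem hf.zero_mem_interior_support _
    have hcov : covMatrix (Ω.indicator f) = covMatrix f := by
      ext i j
      simp only [covMatrix, Matrix.of_apply, hint]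
      congr 1
      refine integral_congr_ae ?_
      filter_upwards [hae] with x hx
      rw [hx]
    rw [funConst, funConst, hint, h0, hcov]

end IsEvenLogConcaveDensity

/-! ### Moments of exponentials and of powers. -/

theorem integrableOn_exp_mul_pow (q : ℕ) {b : ℝ} (hb : 0 < b) :
    IntegrableOn (fun r : ℝ => Real.exp (-(b * r)) * r ^ q) (Ioi 0) := by
  have := integrableOn_rpow_mul_exp_neg_mul_rpow (p := 1) (s := q) (b := b)
    (by have : (0:ℝ) ≤ q := by positivity
        linarith) one_pos hb
  refine this.congr_fun (fun r hr => ?_) measurableSet_Ioi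
  simp [Real.rpow_natCast, mul_comm]

theorem integral_exp_mul_pow (q : ℕ) {b : ℝ} (hb : 0 < b) :
    ∫ r in Ioi (0:ℝ), Real.exp (-(b * r)) * r ^ q = q.factorial / b ^ (q + 1) := by
  have h := Real.integral_rpow_mul_exp_neg_mul_Ioi (a := q + 1) (r := b) (by positivity) hb
  rw [Real.Gamma_nat_eq_factorial] at h
  have h2 : (1 / b) ^ ((q : ℝ) + 1) * q.factorial = q.factorial / b ^ (q + 1) := by
    have : ((q : ℝ) + 1) = ((q + 1 : ℕ) : ℝ) := by push_cast; ring
    rw [this, Real.rpow_natCast, one_div, inv_pow, div_eq_inv_mul]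
  rw [← h2, ← h]
  refine setIntegral_congr_fun measurableSet_Ioi fun r hr => ?_
  simp [Real.rpow_natCast, mul_comm]

theorem lintegral_exp_mul_pow (q : ℕ) {b : ℝ} (hb : 0 < b) :
    ∫⁻ r in Ioi (0:ℝ), ENNReal.ofReal (Real.exp (-(b * r)) * r ^ q)
      = ENNReal.ofReal (q.factorial / b ^ (q + 1)) := by
  rw [← integral_exp_mul_pow q hb, ofReal_integral_eq_lintegral_ofReal
    (integrableOn_exp_mul_pow q hb)]
  filter_upwards [ae_restrict_mem measurableSet_Ioi] with r hr
  have : (0:ℝ) < r := hr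
  simp only [Pi.zero_apply]; positivity

theorem lintegral_pow_Ioc (q : ℕ) {ρ : ℝ} (hρ : 0 ≤ ρ) :
    ∫⁻ r in Ioc (0:ℝ) ρ, ENNReal.ofReal (r ^ q) = ENNReal.ofReal (ρ ^ (q + 1) / (q + 1)) := by
  rw [← ofReal_integral_eq_lintegral_ofReal]
  · rw [← intervalIntegral.integral_of_le hρ, integral_pow]; simp
  · exact (intervalIntegral.intervalIntegrable_pow q).1
  · filter_upwards [ae_restrict_mem measurableSet_Ioc] with r hr
    have : (0:ℝ) < r := hr.1
    simp only [Pi.zero_apply]; positivity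

/-! ### Ball's body: homogeneity, convexity, boundedness, interior. -/

/-- The moment of order `q` of `f` along the ray through `x`. -/
noncomputable def rayMoment (f : E n → ℝ) (q : ℕ) (x : E n) : ℝ≥0∞ :=
  ∫⁻ r in Ioi (0:ℝ), ENNReal.ofReal (f (r • x) * r ^ q)

/-- Ball's body of a density. -/
def ballBody (f : E n → ℝ) : Set (E n) :=
  {x | ENNReal.ofReal (f 0 / (n + 2)) ≤ rayMoment f (n + 1) x}

/-- Substituting `c * r` for `r` shows homogeneity of degree `-(q + 1)`; this turns membership in
Ball's body into a bound on the radius. -/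
theorem rayMoment_smul (f : E n → ℝ) (q : ℕ) (x : E n) {c : ℝ} (hc : 0 < c) :
    ENNReal.ofReal (c ^ (q + 1)) * rayMoment f q (c • x) = rayMoment f q x := by
  have himg : (fun r : ℝ => c * r) '' Ioi 0 = Ioi 0 := by
    ext y
    simp only [mem_image, mem_Ioi]
    refine ⟨fun ⟨r, hr, h⟩ => h ▸ mul_pos hc hr, fun hy => ⟨y / c, by positivity, by field_simp⟩⟩
  have h := lintegral_image_eq_lintegral_abs_deriv_mul (s := Ioi (0:ℝ)) (f := fun r => c * r)
    (f' := fun _ => c) measurableSet_Ioi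
    (fun r _ => by simpa using ((hasDerivAt_id r).const_mul c).hasDerivWithinAt)
    (mul_right_injective₀ hc.ne').injOn (fun r => ENNReal.ofReal (f (r • x) * r ^ q))
  rw [himg] at h
  rw [rayMoment, rayMoment, h, ← lintegral_const_mul' _ _ ENNReal.ofReal_ne_top]
  refine setLIntegral_congr_fun measurableSet_Ioi fun r hr => ?_
  have hr : (0:ℝ) < r := hr
  beta_reduce
  rw [abs_of_pos hc, ← ENNReal.ofReal_mul (by positivity), ← ENNReal.ofReal_mul hc.le, smul_smul,
    mul_comm r c]
  congr 1
  ring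

namespace IsEvenLogConcaveDensity

variable {f : E n → ℝ}

theorem le_smul (hf : IsEvenLogConcaveDensity f) {b : ℝ} (hb0 : 0 ≤ b) (hb1 : b ≤ 1) (x : E n) :
    f x ≤ f (b • x) := by
  by_cases hx : f x = 0
  · rw [hx]; exact hf.logConcave.nonneg _
  have hpos : 0 < f x := (hf.logConcave.nonneg x).lt_of_ne' hx
  have := hf.logConcave.convex_superlevel hpos (x := x) (y := 0) (le_refl (f x)) (hf.le_zero x)
    (a := b) (b := 1 - b) hb0 (by linarith) (by ring)
  simpa using this

theorem measurable (hf : IsEvenLogConcaveDensity f) (ho : IsOpen (Function.support f)) :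
    Measurable f := by
  classical
  have h := hf.continuousOn_interior_support
  rw [ho.interior_eq] at h
  have : f = (Function.support f).piecewise f 0 := by
    ext x
    by_cases hx : x ∈ Function.support f
    · simp [hx]
    · rw [piecewise_eq_of_notMem _ _ _ hx]; simpa using hx
  rw [this]
  exact h.measurable_piecewise continuous_zero.continuousOn ho.measurableSet

theorem integrableOn_ray (hf : IsEvenLogConcaveDensity f) (ho : IsOpen (Function.support f))
    (q : ℕ) {x : E n} (hx : x ≠ 0) :
    IntegrableOn (fun r : ℝ => f (r • x) * r ^ q) (Ioi 0) := by
  obtain ⟨R, hR, hd⟩ := hf.exists_decay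
  have hxp : 0 < ‖x‖ := norm_pos_iff.2 hx
  have hi := (integrableOn_exp_mul_pow q (b := ‖x‖ / R) (by positivity)).const_mul
    (f 0 * Real.exp 1)
  have hm := hf.measurable ho
  refine hi.mono' (by fun_prop) ?_
  filter_upwards [ae_restrict_mem measurableSet_Ioi] with r hr
  have hr : (0:ℝ) < r := hr
  have h1 := hd (r • x)
  rw [norm_smul, Real.norm_of_nonneg hr.le] at h1
  rw [Real.norm_of_nonneg (mul_nonneg (hf.logConcave.nonneg _) (by positivity)), ← mul_assoc]
  gcongr
  rwa [div_mul_eq_mul_div, mul_comm ‖x‖ r]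

theorem ofReal_integral_ray (hf : IsEvenLogConcaveDensity f) (ho : IsOpen (Function.support f))
    (q : ℕ) {x : E n} (hx : x ≠ 0) :
    ENNReal.ofReal (∫ r in Ioi (0:ℝ), f (r • x) * r ^ q) = rayMoment f q x := by
  rw [rayMoment, ofReal_integral_eq_lintegral_ofReal (hf.integrableOn_ray ho q hx)]
  filter_upwards [ae_restrict_mem measurableSet_Ioi] with r hr
  have hr : (0:ℝ) < r := hr
  exact mul_nonneg (hf.logConcave.nonneg _) (by positivity)

/-- For nonzero points this is `ball_ineq` applied to the restrictions of `f` to the two rays. The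
origin is separate, because the ray moment there is infinite; star-shapedness suffices, as `f` does
not increase along rays. -/
theorem convex_ballBody (hf : IsEvenLogConcaveDensity f) (ho : IsOpen (Function.support f)) :
    Convex ℝ (ballBody f) := by
  have hstar : ∀ x ∈ ballBody f, ∀ b : ℝ, 0 ≤ b → b ≤ 1 → b • x ∈ ballBody f := by
    intro x hx b hb0 hb1
    refine le_trans (show _ ≤ _ from hx) (setLIntegral_mono' measurableSet_Ioi fun r hr => ?_)
    have hr : (0:ℝ) < r := hr
    apply ENNReal.ofReal_le_ofReal
    rw [smul_comm r b]
    gcongr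
    exact hf.le_smul hb0 hb1 _
  rw [convex_iff_forall_pos]
  intro x hx y hy a b ha hb hab
  rcases eq_or_ne x 0 with rfl | hx0
  · rw [smul_zero, zero_add]; exact hstar y hy b hb.le (by linarith)
  rcases eq_or_ne y 0 with rfl | hy0
  · rw [smul_zero, add_zero]; exact hstar x hx a ha.le (by linarith)
  have h0 := hf.zero_pos
  have hc : 0 < f 0 / (n + 2) := by positivity
  -- Transport needs positive continuous densities on open intervals; openness of the support
  -- supplies both.
  set W : E n → Set ℝ := fun z => Ioi 0 ∩ (fun r : ℝ => r • z) ⁻¹' Function.support f with hW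
  have hWo : ∀ z, IsOpen (W z) := fun z => isOpen_Ioi.inter (ho.preimage (by fun_prop))
  have hWc : ∀ z, (W z).OrdConnected := fun z => by
    apply Convex.ordConnected
    refine (convex_Ioi 0).inter ?_
    exact hf.logConcave.concaveOn_log.1.linear_preimage ((LinearMap.id : ℝ →ₗ[ℝ] ℝ).smulRight z)
  have hcont : ∀ z, ContinuousOn (fun r : ℝ => f (r • z)) (W z) := fun z => by
    have h := hf.continuousOn_interior_support
    rw [ho.interior_eq] at h
    exact h.comp (by fun_prop) fun r hr => hr.2
  have hint : ∀ z, z ≠ 0 → IntegrableOn (fun r : ℝ => f (r • z) * r ^ (n + 1)) (W z) :=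
    fun z hz => (hf.integrableOn_ray ho _ hz).mono_set inter_subset_left
  have hmass : ∀ z, z ≠ 0 → z ∈ ballBody f →
      f 0 / (n + 2) ≤ ∫ r in W z, f (r • z) * r ^ (n + 1) := by
    intro z hz hzK
    have h1 : ∫ r in W z, f (r • z) * r ^ (n + 1) = ∫ r in Ioi (0:ℝ), f (r • z) * r ^ (n + 1) := by
      symm
      refine setIntegral_eq_of_subset_of_forall_sdiff_eq_zero measurableSet_Ioi inter_subset_left
        fun r hr => ?_
      have : f (r • z) = 0 := by
        by_contra hne
        exact hr.2 ⟨hr.1, hne⟩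
      rw [this, zero_mul]
    have h2 : ENNReal.ofReal (f 0 / (n + 2)) ≤ rayMoment f (n + 1) z := hzK
    rw [← hf.ofReal_integral_ray ho _ hz] at h2
    rw [h1]
    refine (ENNReal.ofReal_le_ofReal_iff (setIntegral_nonneg measurableSet_Ioi fun r hr => ?_)).1 h2
    have hr : (0:ℝ) < r := hr
    exact mul_nonneg (hf.logConcave.nonneg _) (by positivity)
  refine ball_ineq (hWo x) (hWc x) (hWo y) (hWc y) (fun r hr => hr.1) (fun r hr => hr.1) ha hb hab
    (hcont x) (fun r hr => (hf.logConcave.nonneg _).lt_of_ne' hr.2) (hint x hx0)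
    (hcont y) (fun r hr => (hf.logConcave.nonneg _).lt_of_ne' hr.2) (hint y hy0)
    hc (hmass x hx0 hx) (hmass y hy0 hy) (m := fun t => f (t • (a • x + b • y))) ?_
  intro r hr s hs
  have hr0 : 0 < r := hr.1
  have hs0 : 0 < s := hs.1
  set t := (a / r + b / s)⁻¹ with ht
  have htp : 0 < t := by positivity
  have h1 : a * t / r + b * t / s = 1 := by
    have : (a / r + b / s) * t = 1 := mul_inv_cancel₀ (by positivity)
    rw [← this]; ring
  refine (hf.logConcave.rpow_mul_rpow_le hr.2 hs.2 (by positivity) (by positivity) h1).trans_eq ?_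
  congr 1
  rw [smul_smul, smul_smul, smul_add, smul_smul, smul_smul, div_mul_cancel₀ _ hr0.ne',
    div_mul_cancel₀ _ hs0.ne', mul_comm t, mul_comm t]

theorem isBody_ballBody (hf : IsEvenLogConcaveDensity f) (ho : IsOpen (Function.support f)) :
    IsBody (ballBody f) := by
  have h0 := hf.zero_pos
  refine ⟨hf.convex_ballBody ho, fun x hx => ?_, ?_, ?_⟩
  · have : rayMoment f (n + 1) (-x) = rayMoment f (n + 1) x := by simp [rayMoment, hf.even]
    have hx : _ ≤ rayMoment f (n + 1) x := hx
    rwa [← this] at hx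
  · obtain ⟨R, hR, hd⟩ := hf.exists_decay
    rw [isBounded_iff_forall_norm_le]
    -- Decay bounds `‖x‖ ^ (n + 2)`, and this dominates `‖x‖` only when `‖x‖ ≥ 1`.
    refine ⟨max 1 (Real.exp 1 * (n + 1).factorial * (n + 2) * R ^ (n + 2)), fun x hx => ?_⟩
    rcases le_or_gt ‖x‖ 1 with hx1 | hx1
    · exact hx1.trans (le_max_left _ _)
    refine le_max_of_le_right ?_
    have hxp : 0 < ‖x‖ := by linarith
    have hb : 0 < ‖x‖ / R := by positivity
    have hup : rayMoment f (n + 1) x ≤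
        ENNReal.ofReal (f 0 * Real.exp 1 * ((n + 1).factorial / (‖x‖ / R) ^ (n + 2))) := by
      rw [ENNReal.ofReal_mul (by positivity), ← lintegral_exp_mul_pow (n + 1) hb,
        ← lintegral_const_mul' _ _ ENNReal.ofReal_ne_top]
      refine setLIntegral_mono' measurableSet_Ioi fun r hr => ?_
      have hr : (0:ℝ) < r := hr
      rw [← ENNReal.ofReal_mul (by positivity), ← mul_assoc]
      apply ENNReal.ofReal_le_ofReal
      have h1 := hd (r • x)
      rw [norm_smul, Real.norm_of_nonneg hr.le] at h1
      gcongr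
      rwa [div_mul_eq_mul_div, mul_comm ‖x‖ r]
    have h2 := (ENNReal.ofReal_le_ofReal_iff (by positivity)).1
      ((show ENNReal.ofReal (f 0 / (n + 2)) ≤ _ from hx).trans hup)
    have h3 : ‖x‖ ^ (n + 2) ≤ Real.exp 1 * (n + 1).factorial * (n + 2) * R ^ (n + 2) := by
      rw [div_pow, div_div_eq_mul_div, mul_div_assoc', div_le_div_iff₀ (by positivity)
        (by positivity)] at h2
      have : f 0 * ‖x‖ ^ (n + 2) ≤
          f 0 * (Real.exp 1 * (n + 1).factorial * (n + 2) * R ^ (n + 2)) := by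
        linarith
      exact le_of_mul_le_mul_left this h0
    exact (le_self_pow₀ hx1.le (by omega)).trans h3
  · refine ⟨0, mem_interior_iff_mem_nhds.2 ?_⟩
    obtain ⟨ε, hε, hb⟩ := Metric.eventually_nhds_iff.1 (hf.eventually_lt (half_lt_self h0))
    -- For `‖x‖ < ε / 2` the bound `f (r • x) > f 0 / 2` holds up to `r = 2`, and the interval `(0,
    -- 2]` alone already gives `2 ^ (n + 1)` times the required moment.
    refine Metric.mem_nhds_iff.2 ⟨ε / 2, by positivity, fun x hx => ?_⟩
    have hx : ‖x‖ < ε / 2 := by simpa using hx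
    calc ENNReal.ofReal (f 0 / (n + 2))
        ≤ ENNReal.ofReal (f 0 / 2 * (2 ^ (n + 1 + 1) / ((n + 1 : ℕ) + 1))) := by
          apply ENNReal.ofReal_le_ofReal
          have : (1:ℝ) ≤ 2 ^ (n + 1) := one_le_pow₀ (by norm_num)
          have h2 : f 0 / 2 * (2 ^ (n + 1 + 1) / ((n + 1 : ℕ) + 1)) =
              f 0 / (n + 2) * 2 ^ (n + 1) := by
            push_cast
            rw [pow_succ]
            field_simp
            ring
          rw [h2]
          exact le_mul_of_one_le_right (by positivity) this
      _ = ∫⁻ r in Ioc (0:ℝ) 2, ENNReal.ofReal (f 0 / 2) * ENNReal.ofReal (r ^ (n + 1)) := by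
          rw [lintegral_const_mul' _ _ ENNReal.ofReal_ne_top, lintegral_pow_Ioc _ (by norm_num),
            ← ENNReal.ofReal_mul (by positivity)]
      _ ≤ ∫⁻ r in Ioc (0:ℝ) 2, ENNReal.ofReal (f (r • x) * r ^ (n + 1)) := by
          refine setLIntegral_mono' measurableSet_Ioc fun r hr => ?_
          have hr0 : 0 < r := hr.1
          have hr2 : r ≤ 2 := hr.2
          rw [← ENNReal.ofReal_mul (by positivity)]
          apply ENNReal.ofReal_le_ofReal
          gcongr
          refine (hb ?_).le
          rw [dist_zero_right, norm_smul, Real.norm_of_nonneg hr0.le]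
          nlinarith [norm_nonneg x]
      _ ≤ _ := lintegral_mono_set fun r hr => hr.1

end IsEvenLogConcaveDensity

/-! ### Polar coordinates and a factorial estimate. -/

/-- Integration in polar coordinates. -/
theorem lintegral_polar (hn : 1 ≤ n) {F : E n → ℝ≥0∞} (hF : Measurable F) :
    ∫⁻ x, F x = ∫⁻ u : Metric.sphere (0 : E n) 1, (∫⁻ r in Ioi (0:ℝ),
      F (r • (u : E n)) * ENNReal.ofReal (r ^ (n - 1))) ∂(volume : Measure (E n)).toSphere := by
  have : Nonempty (Fin n) := ⟨⟨0, hn⟩⟩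
  have : Nontrivial (E n) := inferInstance
  set μ : Measure (E n) := volume
  have hmeas : Measurable fun p : Metric.sphere (0 : E n) 1 × Ioi (0:ℝ) =>
      F ((p.2 : ℝ) • (p.1 : E n)) := hF.comp (by fun_prop)
  calc ∫⁻ x, F x ∂μ = ∫⁻ x : ({(0)}ᶜ : Set (E n)), F x.1 ∂(μ.comap (↑)) := by
        rw [lintegral_subtype_comap (measurableSet_singleton _).compl, restrict_compl_singleton]
    _ = ∫⁻ p, F ((p.2 : ℝ) • (p.1 : E n))
          ∂(μ.toSphere.prod (.volumeIoiPow (Module.finrank ℝ (E n) - 1))) := by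
        rw [← μ.measurePreserving_homeomorphUnitSphereProd.lintegral_comp_emb
          (Homeomorph.measurableEmbedding _)]
        refine lintegral_congr fun x => ?_
        have hx : ‖x.1‖ ≠ 0 := norm_ne_zero_iff.2 x.2
        simp [smul_smul, mul_inv_cancel₀ hx]
    _ = _ := by
        rw [lintegral_prod _ hmeas.aemeasurable, finrank_euclideanSpace_fin]
        refine lintegral_congr fun u => ?_
        have h2 : Measurable fun r : ℝ => F (r • (u : E n)) := hF.comp (by fun_prop)
        have h3 := h2.comp (measurable_subtype_coe (p := (· ∈ Ioi (0:ℝ))))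
        simp only [Function.comp_def] at h3
        rw [Measure.volumeIoiPow, lintegral_withDensity_eq_lintegral_mul _ (by fun_prop) h3, ← lintegral_subtype_comap measurableSet_Ioi]
        refine lintegral_congr fun r => ?_
        simp [mul_comm]

/-- Combine `(n + 2)! ≤ (n + 2)² n!` with `(n + 2) ^ n ≤ exp (n + 2) * n!`, a single term of the
exponential series. -/
theorem factorial_pow_le (n : ℕ) :
    ((n + 2).factorial : ℝ) ^ n ≤ (Real.exp 2 * n.factorial) ^ (n + 2) := by
  have h1 : ((n : ℝ) + 2) ^ n ≤ Real.exp (n + 2) * n.factorial := by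
    have := Real.pow_div_factorial_le_exp (x := (n : ℝ) + 2) (by positivity) n
    rwa [div_le_iff₀ (by positivity)] at this
  have h2 : ((n + 2).factorial : ℝ) ≤ (n + 2) ^ 2 * n.factorial := by
    rw [Nat.factorial_succ, Nat.factorial_succ]
    push_cast
    have : (0:ℝ) < n.factorial := by positivity
    nlinarith
  calc ((n + 2).factorial : ℝ) ^ n ≤ (((n:ℝ) + 2) ^ 2 * n.factorial) ^ n := by gcongr
    _ = (((n:ℝ) + 2) ^ n) ^ 2 * (n.factorial : ℝ) ^ n := by
        rw [mul_pow, ← pow_mul, ← pow_mul, mul_comm 2 n]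
    _ ≤ (Real.exp (n + 2) * n.factorial) ^ 2 * (n.factorial : ℝ) ^ n := by gcongr
    _ = _ := by
        rw [mul_pow, mul_pow, ← Real.exp_nat_mul, ← Real.exp_nat_mul, mul_assoc, ← pow_add,
          add_comm 2 n]
        push_cast
        ring_nf

theorem pow_le_of_pow_le_factorial {x : ℝ} (hx : 0 ≤ x) (h : x ^ (n + 2) ≤ (n + 2).factorial) :
    x ^ n ≤ Real.exp 2 * n.factorial := by
  refine le_of_pow_le_pow_left₀ (n := n + 2) (by omega) (by positivity) ?_
  rw [← pow_mul, mul_comm, pow_mul]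
  exact (pow_le_pow_left₀ (by positivity) h n).trans (factorial_pow_le n)

/-! ### Ray moments, and the second moments and volume of Ball's body. -/

namespace IsEvenLogConcaveDensity

variable {f : E n → ℝ}

theorem integral_ray_pos (hf : IsEvenLogConcaveDensity f) (ho : IsOpen (Function.support f))
    (q : ℕ) {x : E n} (hx : x ≠ 0) : 0 < ∫ r in Ioi (0:ℝ), f (r • x) * r ^ q := by
  have h0 := hf.zero_pos
  rw [setIntegral_pos_iff_support_of_nonneg_ae _ (hf.integrableOn_ray ho q hx)]
  · obtain ⟨ε, hε, hb⟩ := hf.exists_ball_subset_support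
    have hxp : 0 < ‖x‖ := norm_pos_iff.2 hx
    have hsub : Ioo 0 (ε / ‖x‖) ⊆
        Function.support (fun r : ℝ => f (r • x) * r ^ q) ∩ Ioi 0 := by
      rintro r ⟨hr0, hr1⟩
      refine ⟨mul_ne_zero (hb ?_) (by positivity), hr0⟩
      rw [mem_ball_zero_iff, norm_smul, Real.norm_of_nonneg hr0.le]
      exact (lt_div_iff₀ hxp).1 hr1
    refine lt_of_lt_of_le ?_ (measure_mono hsub)
    rw [Real.volume_Ioo, sub_zero, ENNReal.ofReal_pos]
    positivity
  · filter_upwards [ae_restrict_mem measurableSet_Ioi] with r hr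
    have hr : (0:ℝ) < r := hr
    exact mul_nonneg (hf.logConcave.nonneg _) (by positivity)

/-- Comparison of the moments along a ray with those of an exponential. -/
theorem integral_ray_le (hf : IsEvenLogConcaveDensity f) (ho : IsOpen (Function.support f))
    {x : E n} (hx : x ≠ 0) (q : ℕ) {b : ℝ} (hb : 0 < b)
    (h : ∫ r in Ioi (0:ℝ), f (r • x) * r ^ q < f 0 * (q.factorial / b ^ (q + 1))) :
    ∫ r in Ioi (0:ℝ), f (r • x) * r ^ (q + 2) ≤ f 0 * ((q + 2).factorial / b ^ (q + 3)) := by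
  have h0 := hf.zero_pos
  set φ : ℝ → ℝ := fun r => f (r • x) with hφ
  set ψ : ℝ → ℝ := fun r => f 0 * Real.exp (-(b * r)) with hψ
  have hψi : ∀ q, IntegrableOn (fun r => ψ r * r ^ q) (Ioi 0) := fun q => by
    simp only [hψ, mul_assoc]
    exact (integrableOn_exp_mul_pow q hb).const_mul _
  have hψI : ∀ q : ℕ, ∫ r in Ioi (0:ℝ), ψ r * r ^ q = f 0 * (q.factorial / b ^ (q + 1)) :=
    fun q => by
      simp only [hψ, mul_assoc]
      rw [integral_const_mul, integral_exp_mul_pow q hb]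
  have hφi : ∀ q, IntegrableOn (fun r => φ r * r ^ q) (Ioi 0) :=
    fun q => hf.integrableOn_ray ho q hx
  rw [← hψI] at h ⊢
  -- The infimum of `A` is the crossing point. The strict hypothesis on the moments of order `q`
  -- makes `A` nonempty.
  set A : Set ℝ := {r | 0 < r ∧ φ r < ψ r} with hA
  have hAne : A.Nonempty := by
    by_contra hAe
    rw [not_nonempty_iff_eq_empty] at hAe
    refine absurd h (not_lt.2 (setIntegral_mono_on (hψi q) (hφi q) measurableSet_Ioi
      fun r hr => ?_))
    have hr : (0:ℝ) < r := hr
    have : ψ r ≤ φ r := by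
      by_contra! hlt
      exact (hAe ▸ (⟨hr, hlt⟩ : r ∈ A) : r ∈ (∅ : Set ℝ))
    gcongr
  have hAb : BddBelow A := ⟨0, fun r hr => hr.1.le⟩
  set r₀ := sInf A with hr₀
  have hr₀0 : 0 ≤ r₀ := le_csInf hAne fun r hr => hr.1.le
  have hlow : ∀ r, 0 < r → r < r₀ → ψ r ≤ φ r := by
    intro r hr hlt
    by_contra! hc
    exact (csInf_le hAb (⟨hr, hc⟩ : r ∈ A)).not_gt hlt
  have hup : ∀ r, r₀ < r → φ r ≤ ψ r := by
    intro r hlt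
    obtain ⟨s, ⟨hs0, hs⟩, hsr⟩ := exists_lt_of_csInf_lt hAne hlt
    by_contra! hc
    -- `log ψ` is affine and `φ`, `ψ` agree at 0, so by concavity `φ > ψ` at `r` would force `φ ≥ ψ`
    -- at the earlier point `s`.
    have hrp : 0 < r := hs0.trans hsr
    have hψp : 0 < ψ r := by simp only [hψ]; positivity
    have ht1 : s / r ≤ 1 := (div_le_one hrp).2 hsr.le
    have h1 := hf.logConcave.rpow_mul_rpow_le (x := r • x) (y := 0) (hψp.trans hc).ne' h0.ne'
      (a := s / r) (b := 1 - s / r) (by positivity) (sub_nonneg.2 ht1) (by ring)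
    rw [smul_zero, add_zero, smul_smul, div_mul_cancel₀ _ hrp.ne'] at h1
    have h2 : ψ s = ψ r ^ (s / r) * f 0 ^ (1 - s / r) := by
      simp only [hψ]
      rw [Real.mul_rpow h0.le (by positivity), ← Real.exp_mul, mul_right_comm, ← Real.rpow_add h0,
        add_sub_cancel, Real.rpow_one]
      congr 2
      field_simp
    have h3 : ψ r ^ (s / r) * f 0 ^ (1 - s / r) ≤ φ r ^ (s / r) * f 0 ^ (1 - s / r) := by gcongr
    rw [← h2] at h3
    exact absurd hs (not_lt.2 (h3.trans h1))
  -- Both `φ - ψ` and `r ^ 2 - r₀ ^ 2` change sign at `r₀`, in opposite directions, so their product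
  -- is nowhere positive.
  have hle : ∫ r in Ioi (0:ℝ), ((φ r * r ^ (q + 2) - ψ r * r ^ (q + 2)) -
      r₀ ^ 2 * (φ r * r ^ q - ψ r * r ^ q)) ≤ 0 := by
    refine setIntegral_nonpos measurableSet_Ioi fun r hr => ?_
    have hr : (0:ℝ) < r := hr
    have heq : (φ r * r ^ (q + 2) - ψ r * r ^ (q + 2)) - r₀ ^ 2 * (φ r * r ^ q - ψ r * r ^ q)
        = r ^ q * ((φ r - ψ r) * ((r - r₀) * (r + r₀))) := by ring
    rw [heq]
    refine mul_nonpos_of_nonneg_of_nonpos (by positivity) ?_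
    have hsum : 0 ≤ r + r₀ := by linarith
    rcases lt_trichotomy r r₀ with hlt | rfl | hlt
    · have := hlow r hr hlt
      exact mul_nonpos_of_nonneg_of_nonpos (by linarith)
        (mul_nonpos_of_nonpos_of_nonneg (by linarith) hsum)
    · simp
    · have := hup r hlt
      exact mul_nonpos_of_nonpos_of_nonneg (by linarith) (mul_nonneg (by linarith) hsum)
  have hsub := integral_sub ((hφi (q + 2)).sub (hψi (q + 2)))
    (((hφi q).sub (hψi q)).const_mul (r₀ ^ 2))
  simp only [Pi.sub_apply] at hsub
  rw [hsub, integral_const_mul, integral_sub (hφi _) (hψi _), integral_sub (hφi _) (hψi _)] at hle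
  have : r₀ ^ 2 * ((∫ r in Ioi (0:ℝ), φ r * r ^ q) - ∫ r in Ioi (0:ℝ), ψ r * r ^ q) ≤ 0 :=
    mul_nonpos_of_nonneg_of_nonpos (by positivity) (by linarith)
  linarith

/-- The radius of Ball's body in a given direction. -/
theorem exists_radius (hf : IsEvenLogConcaveDensity f) (ho : IsOpen (Function.support f))
    {x : E n} (hx : x ≠ 0) :
    ∃ ρ : ℝ, 0 ≤ ρ ∧ (∀ r : ℝ, 0 < r → (r • x ∈ ballBody f ↔ r ≤ ρ)) ∧
      ∫ r in Ioi (0:ℝ), f (r • x) * r ^ (n + 1) = f 0 * (ρ ^ (n + 2) / (n + 2)) := by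
  have h0 := hf.zero_pos
  have hI := hf.integral_ray_pos ho (n + 1) hx
  set I := ∫ r in Ioi (0:ℝ), f (r • x) * r ^ (n + 1) with hIdef
  have hray : rayMoment f (n + 1) x = ENNReal.ofReal I := (hf.ofReal_integral_ray ho _ hx).symm
  set P := (n + 2) * I / f 0 with hP
  have hPp : 0 < P := by positivity
  have hρ : (P ^ (1 / ((n + 2 : ℕ) : ℝ))) ^ (n + 2) = P := by
    rw [one_div, Real.rpow_inv_natCast_pow hPp.le (by omega)]
  refine ⟨P ^ (1 / ((n + 2 : ℕ) : ℝ)), by positivity, fun r hr => ?_, ?_⟩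
  · have hs := rayMoment_smul f (n + 1) x hr
    rw [hray] at hs
    have hc : ENNReal.ofReal (r ^ (n + 1 + 1)) ≠ 0 := by
      rw [Ne, ENNReal.ofReal_eq_zero, not_le]; positivity
    calc r • x ∈ ballBody f ↔ ENNReal.ofReal (f 0 / (n + 2)) ≤ rayMoment f (n + 1) (r • x) := Iff.rfl
      _ ↔ ENNReal.ofReal (r ^ (n + 1 + 1)) * ENNReal.ofReal (f 0 / (n + 2)) ≤ ENNReal.ofReal I := by
          rw [← hs, ENNReal.mul_le_mul_iff_right hc ENNReal.ofReal_ne_top]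
      _ ↔ r ^ (n + 2) ≤ P := by
          rw [← ENNReal.ofReal_mul (by positivity), ENNReal.ofReal_le_ofReal_iff hI.le, hP,
            le_div_iff₀ h0, mul_div_assoc', div_le_iff₀ (by positivity), mul_comm I]
      _ ↔ _ := by
          nth_rewrite 1 [← hρ]
          exact pow_le_pow_iff_left₀ hr.le (by positivity) (by omega)
  · rw [hρ, hP]
    field_simp

theorem measurableSet_ballBody (hf : IsEvenLogConcaveDensity f)
    (ho : IsOpen (Function.support f)) : MeasurableSet (ballBody f) := by
  have hm := hf.measurable ho
  have : Measurable (rayMoment f (n + 1)) := by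
    unfold rayMoment
    apply Measurable.lintegral_prod_right'
      (f := fun p : E n × ℝ => ENNReal.ofReal (f (p.2 • p.1) * p.2 ^ (n + 1)))
    fun_prop
  exact measurableSet_le measurable_const this

theorem lintegral_ballBody_ray {x : E n} {ρ : ℝ} (hρ0 : 0 ≤ ρ)
    (hρ : ∀ r : ℝ, 0 < r → (r • x ∈ ballBody f ↔ r ≤ ρ)) (q : ℕ) :
    ∫⁻ r in Ioi (0:ℝ), (ballBody f).indicator 1 (r • x) * ENNReal.ofReal (r ^ q)
      = ENNReal.ofReal (ρ ^ (q + 1) / (q + 1)) := by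
  rw [← lintegral_pow_Ioc q hρ0, ← Ioi_inter_Iic, inter_comm,
    ← setLIntegral_indicator measurableSet_Iic]
  refine setLIntegral_congr_fun measurableSet_Ioi fun r hr => ?_
  by_cases h : r ≤ ρ
  · rw [indicator_of_mem ((hρ r hr).2 h), indicator_of_mem (mem_Iic.2 h), Pi.one_apply, one_mul]
  · rw [indicator_of_notMem (mt (hρ r hr).1 h), indicator_of_notMem (by simpa using h), zero_mul]

/-- Ball's body has the second moments of the density. -/
theorem lintegral_inner_sq_ballBody (hn : 1 ≤ n) (hf : IsEvenLogConcaveDensity f)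
    (ho : IsOpen (Function.support f)) (θ : E n) :
    ENNReal.ofReal (f 0) * ∫⁻ x in ballBody f, ENNReal.ofReal (inner ℝ x θ ^ 2)
      = ∫⁻ x, ENNReal.ofReal (f x * inner ℝ x θ ^ 2) := by
  have h0 := hf.zero_pos
  have hm := hf.measurable ho
  have hK := hf.measurableSet_ballBody ho
  rw [← lintegral_indicator hK, ← lintegral_const_mul' _ _ ENNReal.ofReal_ne_top,
    lintegral_polar hn (by fun_prop (disch := assumption)), lintegral_polar hn (by fun_prop)]
  refine lintegral_congr fun u => ?_
  have hu : (u : E n) ≠ 0 := ne_zero_of_mem_unit_sphere u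
  obtain ⟨ρ, hρ0, hρ, hI⟩ := hf.exists_radius ho hu
  -- The Jacobian `r ^ (n - 1)` and the factor `r ^ 2` from the squared inner product combine to `r
  -- ^ (n + 1)`, the weight defining Ball's body; `1 ≤ n` makes the natural subtraction exact.
  have hL : ∀ r ∈ Ioi (0:ℝ), ENNReal.ofReal (f 0) * (ballBody f).indicator
      (fun x => ENNReal.ofReal (inner ℝ x θ ^ 2)) (r • (u : E n)) * ENNReal.ofReal (r ^ (n - 1))
      = ENNReal.ofReal (f 0 * inner ℝ (u : E n) θ ^ 2) *
        ((ballBody f).indicator 1 (r • (u : E n)) * ENNReal.ofReal (r ^ (n + 1))) := by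
    intro r hr
    have hr : (0:ℝ) < r := hr
    by_cases hrK : r • (u : E n) ∈ ballBody f
    · rw [indicator_of_mem hrK, indicator_of_mem hrK, Pi.one_apply, one_mul,
        ← ENNReal.ofReal_mul h0.le, ← ENNReal.ofReal_mul (by positivity),
        ← ENNReal.ofReal_mul (by positivity), inner_smul_left]
      congr 1
      obtain ⟨k, rfl⟩ : ∃ k, n = k + 1 := ⟨n - 1, by omega⟩
      simp only [Nat.add_sub_cancel, conj_trivial]
      ring
    · rw [indicator_of_notMem hrK, indicator_of_notMem hrK]; simp
  have hR : ∀ r ∈ Ioi (0:ℝ), ENNReal.ofReal (f (r • (u : E n)) * inner ℝ (r • (u : E n)) θ ^ 2) *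
      ENNReal.ofReal (r ^ (n - 1)) = ENNReal.ofReal (inner ℝ (u : E n) θ ^ 2) *
        ENNReal.ofReal (f (r • (u : E n)) * r ^ (n + 1)) := by
    intro r hr
    have hr : (0:ℝ) < r := hr
    have := hf.logConcave.nonneg (r • (u : E n))
    rw [← ENNReal.ofReal_mul (by positivity), ← ENNReal.ofReal_mul (by positivity),
      inner_smul_left]
    congr 1
    obtain ⟨k, rfl⟩ : ∃ k, n = k + 1 := ⟨n - 1, by omega⟩
    simp only [Nat.add_sub_cancel, conj_trivial]
    ring
  rw [setLIntegral_congr_fun measurableSet_Ioi hL, setLIntegral_congr_fun measurableSet_Ioi hR,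
    lintegral_const_mul' _ _ ENNReal.ofReal_ne_top, lintegral_const_mul' _ _ ENNReal.ofReal_ne_top,
    lintegral_ballBody_ray hρ0 hρ]
  change _ = _ * rayMoment f (n + 1) u
  rw [← hf.ofReal_integral_ray ho _ hu, hI, ← ENNReal.ofReal_mul (by positivity),
    ← ENNReal.ofReal_mul (by positivity)]
  congr 1
  push_cast
  ring

/-- In each direction, `integral_ray_le` bounds the moment of order `n + 1`, hence the radius `ρ`,
by the moment `J` of order `n - 1`. The factorial estimate keeps the loss in `ρ ^ n` independent of
`n`. -/
theorem volume_ballBody_le (hn : 1 ≤ n) (hf : IsEvenLogConcaveDensity f)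
    (ho : IsOpen (Function.support f)) :
    ENNReal.ofReal (f 0) * volume (ballBody f)
      ≤ ENNReal.ofReal (2 * Real.exp 2) * ∫⁻ x, ENNReal.ofReal (f x) := by
  have h0 := hf.zero_pos
  have hm := hf.measurable ho
  have hK := hf.measurableSet_ballBody ho
  rw [← lintegral_indicator_one hK, ← lintegral_const_mul' _ _ ENNReal.ofReal_ne_top,
    ← lintegral_const_mul' _ _ ENNReal.ofReal_ne_top,
    lintegral_polar hn (by fun_prop (disch := assumption)), lintegral_polar hn (by fun_prop)]
  refine lintegral_mono fun u => ?_
  have hu : (u : E n) ≠ 0 := ne_zero_of_mem_unit_sphere u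
  obtain ⟨ρ, hρ0, hρ, hI⟩ := hf.exists_radius ho hu
  simp only [mul_assoc]
  rw [lintegral_const_mul' _ _ ENNReal.ofReal_ne_top, lintegral_const_mul' _ _ ENNReal.ofReal_ne_top,
    lintegral_ballBody_ray hρ0 hρ]
  have hR : ∀ r ∈ Ioi (0:ℝ), ENNReal.ofReal (f (r • (u : E n))) * ENNReal.ofReal (r ^ (n - 1)) =
      ENNReal.ofReal (f (r • (u : E n)) * r ^ (n - 1)) := fun r hr =>
    (ENNReal.ofReal_mul (hf.logConcave.nonneg _)).symm
  rw [setLIntegral_congr_fun measurableSet_Ioi hR]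
  change _ ≤ _ * rayMoment f (n - 1) u
  rw [← hf.ofReal_integral_ray ho _ hu, ← ENNReal.ofReal_mul h0.le,
    ← ENNReal.ofReal_mul (by positivity)]
  apply ENNReal.ofReal_le_ofReal
  have hJ := hf.integral_ray_pos ho (n - 1) hu
  have hcmp := fun b hb => hf.integral_ray_le ho hu (n - 1) (b := b) hb
  obtain ⟨k, rfl⟩ : ∃ k, n = k + 1 := ⟨n - 1, by omega⟩
  simp only [Nat.add_sub_cancel] at hJ hcmp ⊢
  set J := ∫ r in Ioi (0:ℝ), f (r • (u : E (k + 1))) * r ^ k with hJdef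
  -- The rate `b` is chosen so that the exponential has moment `2 * J`; the factor 2 provides the
  -- strict inequality required by the comparison.
  set Q := f 0 * k.factorial / (2 * J) with hQ
  have hQp : 0 < Q := by positivity
  set b := Q ^ (1 / ((k + 1 : ℕ) : ℝ)) with hb
  have hbp : 0 < b := by positivity
  have hbQ : b ^ (k + 1) = Q := by
    rw [hb, one_div, Real.rpow_inv_natCast_pow hQp.le (by omega)]
  have h2J : f 0 * (k.factorial / b ^ (k + 1)) = 2 * J := by
    rw [hbQ, hQ]; field_simp
  have h1 := hcmp b hbp (by rw [h2J]; linarith)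
  rw [hI] at h1
  have h2 : (b * ρ) ^ (k + 1 + 2) ≤ (k + 1 + 2).factorial := by
    have h3 := le_of_mul_le_mul_left h1 h0
    rw [div_le_div_iff₀ (by positivity) (by positivity)] at h3
    rw [mul_pow, Nat.factorial_succ]
    push_cast at h3 ⊢
    linarith
  have h3 := pow_le_of_pow_le_factorial (by positivity) h2
  rw [mul_pow, hbQ, hQ, Nat.factorial_succ] at h3
  have h4 : f 0 * k.factorial * ρ ^ (k + 1) ≤
      Real.exp 2 * ((k + 1 : ℕ) * k.factorial) * (2 * J) := by
    rw [div_mul_eq_mul_div, div_le_iff₀ (by positivity)] at h3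
    exact_mod_cast h3
  have h5 : f 0 * ρ ^ (k + 1) ≤ 2 * Real.exp 2 * J * (k + 1) := by
    have hk : (0:ℝ) < k.factorial := by positivity
    push_cast at h4
    refine le_of_mul_le_mul_left ?_ hk
    linarith
  rw [mul_div_assoc', div_le_iff₀ (by positivity)]
  linarith

end IsEvenLogConcaveDensity

/-! ### Moment matrices and linear images. -/

/-- The matrix of second moments of a measure. -/
noncomputable def momentMatrix (μ : Measure (E n)) : Matrix (Fin n) (Fin n) ℝ :=
  Matrix.of fun i j => ∫ x, x i * x j ∂μ

theorem momentMatrix_isSymm (μ : Measure (E n)) : (momentMatrix μ).IsSymm := by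
  ext i j
  simp [momentMatrix, mul_comm]

theorem inner_eq_sum (x θ : E n) : inner ℝ x θ = ∑ i, x i * θ i := by
  simp [PiLp.inner_apply, mul_comm]

theorem integrable_coord_mul {μ : Measure (E n)}
    (h : ∀ θ : E n, ∫⁻ x, ENNReal.ofReal (inner ℝ x θ ^ 2) ∂μ ≠ ∞) (i j : Fin n) :
    Integrable (fun x : E n => x i * x j) μ := by
  have hsq : ∀ k, Integrable (fun x : E n => x k ^ 2) μ := by
    intro k
    refine ⟨by fun_prop, ?_⟩
    rw [hasFiniteIntegral_iff_ofReal (Eventually.of_forall fun x => sq_nonneg _)]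
    have := h (EuclideanSpace.single k 1)
    simp only [EuclideanSpace.inner_single_right, one_mul, conj_trivial] at this
    exact this.lt_top
  refine ((hsq i).add (hsq j)).mono' (by fun_prop) (Eventually.of_forall fun x => ?_)
  simp only [Pi.add_apply]
  rw [Real.norm_eq_abs, abs_le]
  constructor <;> nlinarith [sq_nonneg (x i + x j), sq_nonneg (x i - x j)]

theorem integral_inner_sq {μ : Measure (E n)}
    (h : ∀ i j, Integrable (fun x : E n => x i * x j) μ) (θ : E n) :
    ∫ x, inner ℝ x θ ^ 2 ∂μ = θ.ofLp ⬝ᵥ momentMatrix μ *ᵥ θ.ofLp := by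
  have h1 : ∀ x : E n, inner ℝ x θ ^ 2 = ∑ i, ∑ j, θ i * θ j * (x i * x j) := by
    intro x
    rw [inner_eq_sum, sq, Finset.sum_mul_sum]
    exact Finset.sum_congr rfl fun i _ => Finset.sum_congr rfl fun j _ => by ring
  simp only [h1]
  rw [integral_finsetSum _ fun i _ => integrable_finsetSum _ fun j _ => (h i j).const_mul _]
  simp only [dotProduct, mulVec, Finset.mul_sum]
  refine Finset.sum_congr rfl fun i _ => ?_
  rw [integral_finsetSum _ fun j _ => (h i j).const_mul _]
  refine Finset.sum_congr rfl fun j _ => ?_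
  rw [integral_const_mul, momentMatrix, Matrix.of_apply]
  ring

/-- Polarization: basis vectors give the diagonal entries, and their pairwise sums the others. -/
theorem eq_of_quadratic_eq {A B : Matrix (Fin n) (Fin n) ℝ} (hA : A.IsSymm) (hB : B.IsSymm)
    (h : ∀ v : Fin n → ℝ, v ⬝ᵥ A *ᵥ v = v ⬝ᵥ B *ᵥ v) : A = B := by
  have hd : ∀ i, A i i = B i i := fun i => by simpa using h (Pi.single i 1)
  ext i j
  have h1 := h (Pi.single i 1 + Pi.single j 1)
  simp only [mulVec_add, add_dotProduct, dotProduct_add, single_one_dotProduct, mulVec_single_one,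
    col_apply, hd] at h1
  have h2 := hA.apply i j
  have h3 := hB.apply i j
  linarith

/-- Proportional quadratic forms have proportional matrices. -/
theorem momentMatrix_eq_smul {μ ν : Measure (E n)} {c : ℝ} (hc : 0 ≤ c)
    (hμ : ∀ θ : E n, ∫⁻ x, ENNReal.ofReal (inner ℝ x θ ^ 2) ∂μ ≠ ∞)
    (h : ∀ θ : E n, ENNReal.ofReal c * ∫⁻ x, ENNReal.ofReal (inner ℝ x θ ^ 2) ∂μ
      = ∫⁻ x, ENNReal.ofReal (inner ℝ x θ ^ 2) ∂ν) :
    momentMatrix ν = c • momentMatrix μ := by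
  have hν : ∀ θ : E n, ∫⁻ x, ENNReal.ofReal (inner ℝ x θ ^ 2) ∂ν ≠ ∞ := fun θ => by
    rw [← h θ]; exact ENNReal.mul_ne_top ENNReal.ofReal_ne_top (hμ θ)
  refine eq_of_quadratic_eq (momentMatrix_isSymm ν) ((momentMatrix_isSymm μ).smul c) fun v => ?_
  have h1 := integral_inner_sq (integrable_coord_mul hμ) (WithLp.toLp 2 v)
  have h2 := integral_inner_sq (integrable_coord_mul hν) (WithLp.toLp 2 v)
  simp only at h1 h2
  rw [smul_mulVec, dotProduct_smul, ← h1, ← h2,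
    integral_eq_lintegral_of_nonneg_ae (Eventually.of_forall fun x => sq_nonneg _) (by fun_prop),
    integral_eq_lintegral_of_nonneg_ae (Eventually.of_forall fun x => sq_nonneg _) (by fun_prop),
    ← h, ENNReal.toReal_mul, ENNReal.toReal_ofReal hc, smul_eq_mul]

/-- The matrix of a linear automorphism in the standard basis. -/
noncomputable def linMatrix (T : E n ≃ₗ[ℝ] E n) : Matrix (Fin n) (Fin n) ℝ :=
  LinearMap.toMatrix (EuclideanSpace.basisFun (Fin n) ℝ).toBasis
    (EuclideanSpace.basisFun (Fin n) ℝ).toBasis (T : E n →ₗ[ℝ] E n)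

theorem linMatrix_mulVec (T : E n ≃ₗ[ℝ] E n) (x : E n) :
    linMatrix T *ᵥ x.ofLp = (T x).ofLp := by
  have := LinearMap.toMatrix_mulVec_repr (EuclideanSpace.basisFun (Fin n) ℝ).toBasis
    (EuclideanSpace.basisFun (Fin n) ℝ).toBasis (T : E n →ₗ[ℝ] E n) x
  have hrepr : ∀ y : E n, ⇑((EuclideanSpace.basisFun (Fin n) ℝ).toBasis.repr y) = y.ofLp :=
    fun y => by ext i; simp
  rwa [hrepr, hrepr] at this

theorem linMatrix_det (T : E n ≃ₗ[ℝ] E n) :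
    (linMatrix T).det = LinearMap.det (T : E n →ₗ[ℝ] E n) := LinearMap.det_toMatrix _ _

theorem det_ne_zero (T : E n ≃ₗ[ℝ] E n) : LinearMap.det (T : E n →ₗ[ℝ] E n) ≠ 0 :=
  (LinearEquiv.isUnit_det' T).ne_zero

theorem exists_linMatrix_eq {B : Matrix (Fin n) (Fin n) ℝ} (hB : B.det ≠ 0) :
    ∃ T : E n ≃ₗ[ℝ] E n, linMatrix T = B := by
  refine ⟨Matrix.toLinearEquiv (EuclideanSpace.basisFun (Fin n) ℝ).toBasis B hB.isUnit, ?_⟩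
  have : ((Matrix.toLinearEquiv (EuclideanSpace.basisFun (Fin n) ℝ).toBasis B hB.isUnit :
      E n ≃ₗ[ℝ] E n) : E n →ₗ[ℝ] E n) = Matrix.toLin (EuclideanSpace.basisFun (Fin n) ℝ).toBasis
      (EuclideanSpace.basisFun (Fin n) ℝ).toBasis B := rfl
  rw [linMatrix, this, LinearMap.toMatrix_toLin]

/-- A linear automorphism is a measurable embedding, so `K` itself need not be measurable. -/
theorem restrict_image (T : E n ≃ₗ[ℝ] E n) (K : Set (E n)) :
    (volume : Measure (E n)).restrict (T '' K) =
      ENNReal.ofReal |LinearMap.det (T : E n →ₗ[ℝ] E n)| • (volume.restrict K).map T := by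
  have hd := det_ne_zero T
  have hmap : (volume : Measure (E n)).map T =
      ENNReal.ofReal |(LinearMap.det (T : E n →ₗ[ℝ] E n))⁻¹| • volume :=
    Measure.map_linearMap_addHaar_eq_smul_addHaar volume hd
  have hemb : MeasurableEmbedding T :=
    T.toContinuousLinearEquiv.toHomeomorph.measurableEmbedding
  have h := hemb.restrict_map volume (T '' K)
  rw [preimage_image_eq _ T.injective, hmap, Measure.restrict_smul] at h
  rw [← h, smul_smul, ← ENNReal.ofReal_mul (abs_nonneg _), ← abs_mul, mul_inv_cancel₀ hd]
  simp

/-- The second moments of a linear image. -/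
theorem integral_inner_sq_image (T : E n ≃ₗ[ℝ] E n) {K : Set (E n)}
    (h : ∀ i j, Integrable (fun x : E n => x i * x j) (volume.restrict K)) (θ : E n) :
    ∫ x in T '' K, inner ℝ x θ ^ 2 = θ.ofLp ⬝ᵥ (|LinearMap.det (T : E n →ₗ[ℝ] E n)| •
      (linMatrix T * momentMatrix (volume.restrict K) * (linMatrix T)ᵀ)) *ᵥ θ.ofLp := by
  have hemb : MeasurableEmbedding T :=
    T.toContinuousLinearEquiv.toHomeomorph.measurableEmbedding
  have hadj : ∀ x : E n, inner ℝ (T x) θ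
      = inner ℝ x (WithLp.toLp 2 ((linMatrix T)ᵀ *ᵥ θ.ofLp)) := by
    intro x
    rw [inner_eq_sum, inner_eq_sum, ← linMatrix_mulVec]
    change (linMatrix T *ᵥ x.ofLp) ⬝ᵥ θ.ofLp = x.ofLp ⬝ᵥ ((linMatrix T)ᵀ *ᵥ θ.ofLp)
    rw [mulVec_transpose, dotProduct_comm, dotProduct_mulVec, dotProduct_comm]
  rw [restrict_image, integral_smul_measure, hemb.integral_map]
  simp only [hadj]
  rw [integral_inner_sq h, ENNReal.toReal_ofReal (abs_nonneg _), smul_mulVec, dotProduct_smul,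
    ← mulVec_mulVec, ← mulVec_mulVec, dotProduct_mulVec θ.ofLp, ← mulVec_transpose]

/-! ### The isotropic constant of a body: existence, uniqueness, bounds. -/

namespace IsBody

variable {K : Set (E n)}

theorem lintegral_inner_sq_ne_top (hK : IsBody K) (θ : E n) :
    ∫⁻ x in K, ENNReal.ofReal (inner ℝ x θ ^ 2) ≠ ∞ := by
  obtain ⟨R, hR⟩ := hK.bounded.subset_closedBall 0
  have hc : IntegrableOn (fun x : E n => inner ℝ x θ ^ 2) (Metric.closedBall 0 R) :=
    ContinuousOn.integrableOn_compact (isCompact_closedBall _ _) (by fun_prop)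
  have := (hc.mono_set hR).2
  rw [hasFiniteIntegral_iff_ofReal (Eventually.of_forall fun x => sq_nonneg _)] at this
  exact this.ne

theorem integrable_coord (hK : IsBody K) (i j : Fin n) :
    Integrable (fun x : E n => x i * x j) (volume.restrict K) :=
  integrable_coord_mul hK.lintegral_inner_sq_ne_top i j

theorem volume_ne_top (hK : IsBody K) : volume K ≠ ∞ := hK.bounded.measure_lt_top.ne

theorem volume_ne_zero (hK : IsBody K) : volume K ≠ 0 := fun h =>
  (isOpen_interior.measure_pos volume hK.interior_nonempty).ne'
    (measure_mono_null interior_subset h)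

theorem toReal_volume_pos (hK : IsBody K) : 0 < (volume K).toReal :=
  ENNReal.toReal_pos hK.volume_ne_zero hK.volume_ne_top

/-- If the form vanished at a nonzero vector, almost all of the interior of `K` would lie in a
hyperplane, which is null. -/
theorem posDef_momentMatrix (hK : IsBody K) : (momentMatrix (volume.restrict K)).PosDef := by
  rw [posDef_iff_dotProduct_mulVec]
  refine ⟨by rw [IsHermitian, conjTranspose_eq_transpose_of_trivial]; exact momentMatrix_isSymm _,
    fun v hv => ?_⟩
  have h1 := integral_inner_sq hK.integrable_coord (WithLp.toLp 2 v)
  simp only at h1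
  rw [star_trivial, ← h1]
  refine (integral_nonneg fun x => sq_nonneg _).lt_of_ne' fun h0 => ?_
  have hint : Integrable (fun x : E n => inner ℝ x (WithLp.toLp 2 v) ^ 2) (volume.restrict K) := by
    refine ⟨by fun_prop, ?_⟩
    rw [hasFiniteIntegral_iff_ofReal (Eventually.of_forall fun x => sq_nonneg _)]
    exact (hK.lintegral_inner_sq_ne_top _).lt_top
  rw [integral_eq_zero_iff_of_nonneg (fun x => sq_nonneg _) hint] at h0
  set w : E n := WithLp.toLp 2 v with hw
  have hw0 : w ≠ 0 := fun h => hv (by simpa [hw] using h)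
  set H : Submodule ℝ (E n) := (innerₛₗ ℝ w).ker with hH
  have hHtop : H ≠ ⊤ := fun h => by
    have : w ∈ H := h ▸ Submodule.mem_top
    simp [hH, hw0] at this
  have hnull := Measure.addHaar_submodule (volume : Measure (E n)) H hHtop
  have hU : interior K ⊆ K := interior_subset
  have h2 : ∀ᵐ x ∂(volume.restrict (interior K)), x ∈ (H : Set (E n)) := by
    filter_upwards [ae_restrict_of_ae_restrict_of_subset hU h0] with x hx
    have : inner ℝ x w = 0 := by simpa using hx
    simpa [hH, real_inner_comm] using this
  rw [ae_restrict_iff' isOpen_interior.measurableSet] at h2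
  have h3 : volume (interior K) = 0 := by
    refine measure_mono_null_ae (t := (H : Set (E n))) ?_ hnull
    filter_upwards [h2] with x hx using hx
  exact (isOpen_interior.measure_pos volume hK.interior_nonempty).ne' h3

/-- Isotropy means `D • (B * A * Bᵀ) = L ^ 2 • 1`, with `B` the matrix of `T`, `D = |det B|` and `D
* V = 1`. Taking determinants eliminates `T`, which gives uniqueness of `L`. -/
theorem pow_of_isIsotropicWith (hK : IsBody K) {T : E n ≃ₗ[ℝ] E n} {L : ℝ}
    (h : IsIsotropicWith (T '' K) L) :
    L ^ (2 * n) * (volume K).toReal ^ (n + 2) = (momentMatrix (volume.restrict K)).det := by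
  set D := |LinearMap.det (T : E n →ₗ[ℝ] E n)| with hD
  set A := momentMatrix (volume.restrict K)
  set V := (volume K).toReal
  have hDV : D * V = 1 := by
    have h1 := h.volume_eq_one
    have h2 : volume (T '' K) = ENNReal.ofReal D * volume K :=
      Measure.addHaar_image_linearMap volume (T : E n →ₗ[ℝ] E n) K
    rw [h2] at h1
    have := congrArg ENNReal.toReal h1
    rwa [ENNReal.toReal_mul, ENNReal.toReal_ofReal (abs_nonneg _), ENNReal.toReal_one] at this
  have hmat : D • (linMatrix T * A * (linMatrix T)ᵀ) = (L ^ 2) • (1 : Matrix (Fin n) (Fin n) ℝ) := by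
    refine eq_of_quadratic_eq (IsSymm.smul ?_ _) (isSymm_one.smul _) fun v => ?_
    · rw [IsSymm, transpose_mul, transpose_mul, transpose_transpose, momentMatrix_isSymm, mul_assoc]
    · rcases eq_or_ne v 0 with rfl | hv
      · simp
      set w : E n := WithLp.toLp 2 v with hw
      have hw0 : w ≠ 0 := fun h => hv (by simpa [hw] using h)
      have hwn : ‖w‖ ≠ 0 := norm_ne_zero_iff.2 hw0
      have h1 := h.integral_eq (‖w‖⁻¹ • w) (by rw [norm_smul, norm_inv, norm_norm,
        inv_mul_cancel₀ hwn])
      simp only [inner_smul_right, mul_pow] at h1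
      rw [integral_const_mul, integral_inner_sq_image T hK.integrable_coord] at h1
      have h2 : v ⬝ᵥ v = ‖w‖ ^ 2 := by
        rw [EuclideanSpace.real_norm_sq_eq, dotProduct]
        exact Finset.sum_congr rfl fun i _ => by rw [hw]; ring
      rw [smul_mulVec (L ^ 2), one_mulVec, dotProduct_smul, h2, smul_eq_mul, ← h1]
      rw [inv_pow, mul_comm, ← mul_assoc, mul_inv_cancel₀ (pow_ne_zero 2 hwn), one_mul]
  have hdet := congrArg Matrix.det hmat
  rw [det_smul, det_smul, det_mul, det_mul, det_transpose, det_one, Fintype.card_fin, mul_one,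
    linMatrix_det] at hdet
  have hsq : LinearMap.det (T : E n →ₗ[ℝ] E n) * LinearMap.det (T : E n →ₗ[ℝ] E n) = D ^ 2 := by
    rw [hD, sq_abs, sq]
  have h3 : D ^ (n + 2) * A.det = L ^ (2 * n) := by
    rw [pow_mul, ← hdet, pow_add, ← hsq]; ring
  rw [← h3]
  calc D ^ (n + 2) * A.det * V ^ (n + 2) = (D * V) ^ (n + 2) * A.det := by rw [mul_pow]; ring
    _ = A.det := by rw [hDV, one_pow, one_mul]

/-- The map is a multiple of the inverse square root of the moment matrix, scaled to volume one. -/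
theorem exists_isIsotropicWith (hn : 1 ≤ n) (hK : IsBody K) :
    ∃ (T : E n ≃ₗ[ℝ] E n) (L : ℝ), IsIsotropicWith (T '' K) L := by
  set A := momentMatrix (volume.restrict K) with hA
  have hPD := hK.posDef_momentMatrix
  have hV := hK.toReal_volume_pos
  set V := (volume K).toReal with hVdef
  obtain ⟨X, hX, hXX⟩ : ∃ X : Matrix (Fin n) (Fin n) ℝ, Xᵀ = X ∧ X * X = A := by
    open scoped MatrixOrder in
    obtain ⟨X, hX, -, h⟩ := CFC.exists_sqrt_of_isSelfAdjoint_of_quasispectrumRestricts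
      hPD.isHermitian (QuasispectrumRestricts.nnreal_of_nonneg hPD.posSemidef.nonneg)
    exact ⟨X, by rw [← conjTranspose_eq_transpose_of_trivial]; exact hX.star_eq, h⟩
  have hXd : X.det ≠ 0 := by
    intro h
    have := hPD.det_pos
    rw [← hA, ← hXX, det_mul, h, zero_mul] at this
    exact lt_irrefl _ this
  set d := |X.det| with hd
  have hdp : 0 < d := abs_pos.2 hXd
  -- The determinant of `c • X⁻¹` has absolute value `c ^ n / d`, which must equal `1 / V`.
  set c := (d / V) ^ (1 / (n : ℝ)) with hc
  have hcp : 0 < c := by positivity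
  have hcn : c ^ n = d / V := by
    rw [hc, one_div, Real.rpow_inv_natCast_pow (by positivity) (by omega)]
  have hBd : (c • X⁻¹).det = c ^ n * X.det⁻¹ := by
    rw [det_smul, Fintype.card_fin, det_nonsing_inv, Ring.inverse_eq_inv]
  obtain ⟨T, hT⟩ := exists_linMatrix_eq (B := c • X⁻¹) (by rw [hBd]; positivity)
  have hD : |LinearMap.det (T : E n →ₗ[ℝ] E n)| = V⁻¹ := by
    rw [← linMatrix_det, hT, hBd, abs_mul, abs_inv, ← hd, hcn, abs_of_pos (by positivity)]
    field_simp
  have hM : linMatrix T * A * (linMatrix T)ᵀ = (c ^ 2) • (1 : Matrix (Fin n) (Fin n) ℝ) := by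
    have hu : IsUnit X.det := hXd.isUnit
    rw [hT, transpose_smul, transpose_nonsing_inv, hX, ← hXX, smul_mul_assoc, smul_mul_assoc,
      mul_smul_comm, smul_smul, ← sq, ← mul_assoc, nonsing_inv_mul _ hu, one_mul,
      mul_nonsing_inv _ hu]
  refine ⟨T, √(V⁻¹ * c ^ 2), ?_, Real.sqrt_nonneg _, fun θ hθ => ?_⟩
  · have h2 : volume (T '' K) = ENNReal.ofReal |LinearMap.det (T : E n →ₗ[ℝ] E n)| * volume K :=
      Measure.addHaar_image_linearMap volume (T : E n →ₗ[ℝ] E n) K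
    rw [h2, hD, ← ENNReal.ofReal_toReal hK.volume_ne_top, ← ENNReal.ofReal_mul (by positivity),
      inv_mul_cancel₀ hV.ne', ENNReal.ofReal_one]
  · rw [integral_inner_sq_image T hK.integrable_coord, hD, hM, Real.sq_sqrt (by positivity),
      smul_smul, smul_mulVec, one_mulVec, dotProduct_smul, smul_eq_mul]
    have h2 : θ.ofLp ⬝ᵥ θ.ofLp = ‖θ‖ ^ 2 := by
      rw [EuclideanSpace.real_norm_sq_eq, dotProduct]
      exact Finset.sum_congr rfl fun i _ => by ring
    rw [h2, hθ]; ring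

theorem exists_isIsotropicWith_bodyConst (hn : 1 ≤ n) (hK : IsBody K) :
    ∃ T : E n ≃ₗ[ℝ] E n, IsIsotropicWith (T '' K) (bodyConst K) := by
  obtain ⟨T, L, h⟩ := hK.exists_isIsotropicWith hn
  have hset : {L : ℝ | ∃ T : E n ≃ₗ[ℝ] E n, IsIsotropicWith (T '' K) L} = {L} := by
    refine Subset.antisymm ?_ (singleton_subset_iff.2 ⟨T, h⟩)
    rintro L' ⟨T', h'⟩
    have h1 := hK.pow_of_isIsotropicWith h
    rw [← hK.pow_of_isIsotropicWith h'] at h1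
    have h2 := mul_right_cancel₀ (pow_ne_zero _ hK.toReal_volume_pos.ne') h1
    exact ((pow_left_inj₀ h.nonneg h'.nonneg (by omega)).1 h2).symm
  refine ⟨T, ?_⟩
  rw [bodyConst, hset, csSup_singleton]
  exact h

theorem bodyConst_nonneg (hn : 1 ≤ n) (hK : IsBody K) : 0 ≤ bodyConst K :=
  (hK.exists_isIsotropicWith_bodyConst hn).choose_spec.nonneg

theorem bodyConst_pow (hn : 1 ≤ n) (hK : IsBody K) :
    bodyConst K ^ (2 * n) * (volume K).toReal ^ (n + 2)
      = (momentMatrix (volume.restrict K)).det := by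
  obtain ⟨T, h⟩ := hK.exists_isIsotropicWith_bodyConst hn
  exact hK.pow_of_isIsotropicWith h

theorem bodyConst_pos (hn : 1 ≤ n) (hK : IsBody K) : 0 < bodyConst K := by
  refine (hK.bodyConst_nonneg hn).lt_of_ne' fun h => ?_
  have h1 := hK.bodyConst_pow hn
  rw [h, zero_pow (by omega), zero_mul] at h1
  exact hK.posDef_momentMatrix.det_pos.ne h1

/-- A convex symmetric set in isotropic position contains a ball, up to closure. -/
theorem bodyConst_pow_le (hn : 1 ≤ n) (hK : IsBody K) :
    ENNReal.ofReal (bodyConst K ^ n) * volume (Metric.ball (0 : E n) 1) ≤ 1 := by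
  obtain ⟨T, h⟩ := hK.exists_isIsotropicWith_bodyConst hn
  have hL := hK.bodyConst_pos hn
  set L := bodyConst K
  have hc : Convex ℝ (T '' K) := hK.convex.linear_image (T : E n →ₗ[ℝ] E n)
  have hs : ∀ x ∈ T '' K, -x ∈ T '' K := by
    rintro _ ⟨x, hx, rfl⟩
    exact ⟨-x, hK.symm x hx, map_neg T x⟩
  -- A point of norm below `L` outside the closure would be separated from it; by symmetry the set
  -- would lie in a slab of half-width below `L`, making the second moment in that direction less
  -- than `L ^ 2`.
  have hsub : Metric.ball 0 L ⊆ closure (T '' K) := by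
    intro y hy
    by_contra hyK
    obtain ⟨g, u, hgu, huy⟩ := geometric_hahn_banach_closed_point hc.closure isClosed_closure hyK
    set θ : E n := (InnerProductSpace.toDual ℝ (E n)).symm g with hθ
    have hin : ∀ x, inner ℝ x θ = g x := fun x => by
      rw [real_inner_comm, hθ, InnerProductSpace.toDual_symm_apply]
    have hbd : ∀ x ∈ T '' K, inner ℝ x θ ^ 2 ≤ u ^ 2 := by
      intro x hx
      have h1 := hgu x (subset_closure hx)
      have h2 := hgu (-x) (subset_closure (hs x hx))
      rw [map_neg] at h2
      rw [hin]
      exact sq_le_sq' (by linarith) h1.le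
    have hu0 : 0 < u := by
      obtain ⟨x, hx⟩ := (hK.interior_nonempty.mono interior_subset).image T
      have h1 := hgu x (subset_closure hx)
      have h2 := hgu (-x) (subset_closure (hs x hx))
      rw [map_neg] at h2
      linarith
    have hθ0 : 0 < ‖θ‖ := by
      refine norm_pos_iff.2 fun h0 => ?_
      have := hin y
      rw [h0, inner_zero_right] at this
      linarith
    have huy' : u < ‖y‖ * ‖θ‖ := by
      rw [← hin] at huy
      exact huy.trans_le (real_inner_le_norm y θ)
    have hint : ∫ x in T '' K, inner ℝ x (‖θ‖⁻¹ • θ) ^ 2 ≤ (u / ‖θ‖) ^ 2 := by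
      have hvol : volume.real (T '' K) = 1 := by simp [Measure.real, h.volume_eq_one]
      refine (Real.le_norm_self _).trans ((norm_setIntegral_le_of_norm_le_const
        (C := (u / ‖θ‖) ^ 2) (by simp [h.volume_eq_one]) fun x hx => ?_).trans_eq
        (by rw [hvol, mul_one]))
      rw [Real.norm_of_nonneg (sq_nonneg _), inner_smul_right, mul_pow, div_pow, inv_pow,
        inv_mul_eq_div]
      exact div_le_div_of_nonneg_right (hbd x hx) (sq_nonneg _)
    rw [h.integral_eq _ (by rw [norm_smul, norm_inv, norm_norm, inv_mul_cancel₀ hθ0.ne'])] at hint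
    have h1 : L ≤ u / ‖θ‖ := le_of_sq_le_sq hint (by positivity)
    have h2 : ‖y‖ < L := by simpa using hy
    rw [le_div_iff₀ hθ0] at h1
    nlinarith
  have hvol : volume (closure (T '' K)) = 1 := by
    rw [← h.volume_eq_one]
    refine le_antisymm ?_ (measure_mono subset_closure)
    rw [closure_eq_self_union_frontier]
    refine (measure_union_le _ _).trans ?_
    rw [hc.addHaar_frontier volume, add_zero]
  calc ENNReal.ofReal (L ^ n) * volume (Metric.ball (0 : E n) 1)
      = volume (Metric.ball (0 : E n) L) := by
        rw [Measure.addHaar_ball_of_pos volume 0 hL, finrank_euclideanSpace_fin]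
    _ ≤ 1 := (measure_mono hsub).trans hvol.le

end IsBody

/-! ### Finiteness and positivity of the supremum over bodies. -/

/-- The bound depends on `n`; only finiteness in each dimension is needed, to make the final
inequality strict. -/
theorem supBody_ne_top (hn : 1 ≤ n) : supBody n ≠ ∞ := by
  set v := (volume (Metric.ball (0 : E n) 1)).toReal with hv
  have hb0 : volume (Metric.ball (0 : E n) 1) ≠ 0 :=
    (Metric.measure_ball_pos volume _ one_pos).ne'
  have hbt : volume (Metric.ball (0 : E n) 1) ≠ ∞ := measure_ball_lt_top.ne
  have hvp : 0 < v := ENNReal.toReal_pos hb0 hbt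
  refine ne_top_of_le_ne_top (b := ENNReal.ofReal (max 1 v⁻¹)) ENNReal.ofReal_ne_top
    (iSup₂_le fun K hK => ENNReal.ofReal_le_ofReal ?_)
  rcases le_or_gt (bodyConst K) 1 with h1 | h1
  · exact h1.trans (le_max_left _ _)
  refine le_max_of_le_right ((le_self_pow₀ h1.le (by omega : n ≠ 0)).trans ?_)
  have h := hK.bodyConst_pow_le hn
  rw [← ENNReal.ofReal_toReal hbt, ← ENNReal.ofReal_mul (pow_nonneg (by linarith) _),
    ENNReal.ofReal_le_one] at h
  rwa [← one_div, le_div_iff₀ hvp]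

theorem supBody_ne_zero (hn : 1 ≤ n) : supBody n ≠ 0 := by
  have hK : IsBody (Metric.ball (0 : E n) 1) :=
    ⟨convex_ball _ _, fun x hx => by simpa using hx, Metric.isBounded_ball, by
      rw [Metric.isOpen_ball.interior_eq]; exact ⟨0, Metric.mem_ball_self one_pos⟩⟩
  have h1 : 0 < ENNReal.ofReal (bodyConst (Metric.ball (0 : E n) 1)) :=
    ENNReal.ofReal_pos.2 (hK.bodyConst_pos hn)
  exact (h1.trans_le (le_iSup₂ (f := fun (K : Set (E n)) (_ : IsBody K) =>
    ENNReal.ofReal (bodyConst K)) _ hK)).ne'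

/-! ### Comparing the constants of a density and of its Ball body. -/

namespace IsEvenLogConcaveDensity

variable {f : E n → ℝ}

/-- The covariance matrix of a density in terms of the second moments of Ball's body. -/
theorem covMatrix_eq (hn : 1 ≤ n) (hf : IsEvenLogConcaveDensity f)
    (ho : IsOpen (Function.support f)) :
    covMatrix f = (f 0 / ∫ x, f x) • momentMatrix (volume.restrict (ballBody f)) := by
  have hm := hf.measurable ho
  have hK := hf.isBody_ballBody ho
  have h := momentMatrix_eq_smul (μ := volume.restrict (ballBody f))
    (ν := volume.withDensity fun x => ENNReal.ofReal (f x)) hf.zero_pos.le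
    hK.lintegral_inner_sq_ne_top fun θ => by
      rw [hf.lintegral_inner_sq_ballBody hn ho θ,
        lintegral_withDensity_eq_lintegral_mul _ (by fun_prop) (by fun_prop)]
      exact lintegral_congr fun x => ENNReal.ofReal_mul (hf.logConcave.nonneg x)
  have hcov : covMatrix f = (1 / ∫ x, f x) •
      momentMatrix (volume.withDensity fun x => ENNReal.ofReal (f x)) := by
    ext i j
    simp only [covMatrix, momentMatrix, Matrix.of_apply, Matrix.smul_apply, smul_eq_mul]
    rw [integral_withDensity_eq_integral_toReal_smul (by fun_prop)
      (Eventually.of_forall fun x => ENNReal.ofReal_lt_top)]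
    congr 1
    refine integral_congr_ae (Eventually.of_forall fun x => ?_)
    simp only [ENNReal.toReal_ofReal (hf.logConcave.nonneg x), smul_eq_mul, mul_assoc]
  rw [hcov, h, smul_smul]
  congr 1
  ring

/-- With `q = f 0 / ∫ f`, the covariance matrix is `q` times the moment matrix of Ball's body. Its
determinant contributes `q ^ n`, the prefactor of `funConst` contributes `q ^ 2`, and
`bodyConst_pow` supplies the volume to the power `n + 2`. -/
theorem funConst_pow (hn : 1 ≤ n) (hf : IsEvenLogConcaveDensity f)
    (ho : IsOpen (Function.support f)) :
    0 ≤ funConst f ∧ funConst f ^ (2 * n) =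
      (f 0 / (∫ x, f x) * (volume (ballBody f)).toReal) ^ (n + 2)
        * bodyConst (ballBody f) ^ (2 * n) := by
  have h0 := hf.zero_pos
  have hI := hf.integral_pos
  have hK := hf.isBody_ballBody ho
  set q := f 0 / ∫ x, f x with hq
  have hqp : 0 < q := by positivity
  have hdet : (covMatrix f).det = q ^ n * (momentMatrix (volume.restrict (ballBody f))).det := by
    rw [hf.covMatrix_eq hn ho, det_smul, Fintype.card_fin]
  have hdp : 0 < (covMatrix f).det := by
    rw [hdet]
    exact mul_pos (by positivity) hK.posDef_momentMatrix.det_pos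
  rw [← hK.bodyConst_pow hn] at hdet
  have hn0 : n ≠ 0 := by omega
  refine ⟨mul_nonneg (Real.rpow_nonneg hqp.le _) (Real.rpow_nonneg hdp.le _), ?_⟩
  rw [funConst, ← hq, mul_pow]
  have h1 : (q ^ (1 / (n : ℝ))) ^ (2 * n) = q ^ 2 := by
    rw [mul_comm 2 n, pow_mul, one_div, Real.rpow_inv_natCast_pow hqp.le hn0]
  have h2 : ((covMatrix f).det ^ (1 / (2 * (n : ℝ)))) ^ (2 * n) = (covMatrix f).det := by
    have : (2 * (n : ℝ)) = ((2 * n : ℕ) : ℝ) := by push_cast; ring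
    rw [this, one_div, Real.rpow_inv_natCast_pow hdp.le (by omega)]
  rw [h1, h2, hdet, mul_pow]
  ring

theorem funConst_le (hn : 1 ≤ n) (hf : IsEvenLogConcaveDensity f)
    (ho : IsOpen (Function.support f)) :
    funConst f ≤ (2 * Real.exp 2) ^ 2 * bodyConst (ballBody f) := by
  have h0 := hf.zero_pos
  have hI := hf.integral_pos
  have hK := hf.isBody_ballBody ho
  have hL := hK.bodyConst_nonneg hn
  obtain ⟨hnn, hpow⟩ := hf.funConst_pow hn ho
  set C := 2 * Real.exp 2 with hC
  have hC1 : 1 ≤ C := by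
    have : 1 ≤ Real.exp 2 := Real.one_le_exp (by norm_num)
    linarith
  have hratio : f 0 / (∫ x, f x) * (volume (ballBody f)).toReal ≤ C := by
    have h := hf.volume_ballBody_le hn ho
    rw [← ofReal_integral_eq_lintegral_ofReal hf.integrable
      (Eventually.of_forall hf.logConcave.nonneg), ← ENNReal.ofReal_mul (by positivity),
      ← ENNReal.ofReal_toReal hK.volume_ne_top, ← ENNReal.ofReal_mul h0.le,
      ENNReal.ofReal_le_ofReal_iff (by positivity)] at h
    rwa [div_mul_eq_mul_div, div_le_iff₀ hI]
  refine le_of_pow_le_pow_left₀ (n := 2 * n) (by omega) (by positivity) ?_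
  rw [hpow, mul_pow (C ^ 2)]
  refine mul_le_mul_of_nonneg_right ?_ (pow_nonneg hL _)
  calc (f 0 / (∫ x, f x) * (volume (ballBody f)).toReal) ^ (n + 2) ≤ C ^ (n + 2) := by gcongr
    -- Here `n + 2 ≤ 4 * n` because `n ≥ 1`, which makes the constant independent of the dimension.
    _ ≤ C ^ (2 * (2 * n)) := pow_le_pow_right₀ hC1 (by omega)
    _ = (C ^ 2) ^ (2 * n) := pow_mul _ _ _

end IsEvenLogConcaveDensity

theorem supFun_le (hn : 1 ≤ n) :
    supFun n ≤ ENNReal.ofReal ((2 * Real.exp 2) ^ 2) * supBody n := by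
  refine iSup₂_le fun f hf => ?_
  obtain ⟨g, hg, ho, hgf⟩ := hf.exists_open_support
  rw [← hgf]
  refine (ENNReal.ofReal_le_ofReal (hg.funConst_le hn ho)).trans ?_
  rw [ENNReal.ofReal_mul (by positivity)]
  gcongr
  exact le_iSup₂ (f := fun (K : Set (E n)) (_ : IsBody K) => ENNReal.ofReal (bodyConst K))
    _ (hg.isBody_ballBody ho)

end Slicing

theorem corollary2p5 :
    ∃ c : ℝ, 0 < c ∧ ∀ n : ℕ, 1 ≤ n →
      Slicing.supFun n < ENNReal.ofReal c * Slicing.supBody n := by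
  have hpos : (0:ℝ) < (2 * Real.exp 2) ^ 2 := by positivity
  -- Doubling the constant of `supFun_le` gives strictness, since the supremum over bodies is
  -- neither zero nor infinite.
  refine ⟨2 * (2 * Real.exp 2) ^ 2, by positivity, fun n hn => (Slicing.supFun_le hn).trans_lt ?_⟩
  refine ENNReal.mul_lt_mul_left (Slicing.supBody_ne_zero hn) (Slicing.supBody_ne_top hn) ?_
  exact (ENNReal.ofReal_lt_ofReal_iff (by positivity)).2 (by linarith)
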